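/- **Setting.** Let $\mathcal X,\mathcal A$ be finite sets, $\mathcal D$ a probability distribution on $\mathcal X$, $\pi_0:\mathcal X\to\Delta(\mathcal A)$ a base policy, $d\ge 1$, $\phi:\mathcal X\times\mathcal A\to\mathbb R^d$ with $\|\phi(x,a)\|_2\le 1$, $p\in[1,2]$, $R>0$, $\gamma>0$. Write $B_p(\theta_0,r)$ for the closed $\ell^p$ ball, $\sigma(z)=1/(1+e^{-z})$, and $\pi_\theta(a\mid x)\propto\pi_0(a\mid x)\exp(\theta^\top\phi(x,a))$. Let $r^*:\mathcal X\times\mathcal A\to\mathbb R$ be a reward, $\pi^*(a\mid x)\propto\pi_0(a\mid x)\exp(\gamma^{-1}r^*(x,a))$, and assume that $\pi^*=\pi_{\theta^*}$ for some $\theta^*\in B_p(0,R)$. For a policy $\pi$ let $$\mathbb V(\pi)=\mathbb E_{x\sim\mathcal D,\,a\sim\pi(x)}\big[(\phi(x,a)-\mathbb E_{a'\sim\pi(x)}\phi(x,a'))^{\otimes2}\big],$$ $C_{\pi\to\pi'}=\inf\{C>0:\mathbb V(\pi')\preceq C\,\mathbb V(\pi)\}$ and $C_*^p(r)=\sup\{C_{\pi_\theta\to\pi^*}:\theta\in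 B_p(\theta^*,r)\}$. Assume $\mathbb V(\pi^*)\succeq\lambda I_d$ with $\lambda>0$. **Algorithm (on-policy DPO with batch sizes $n_0,\dots,n_{T-1}$).** Start from $\hat\theta_0=0$. In round $k$ draw $n_k$ independent samples: $x\sim\mathcal D$, $a^1,a^2\sim\pi_{\hat\theta_k}(x)$ independently, and $(a^+,a^-)=(a^1,a^2)$ with probability $\sigma(r^*(x,a^1)-r^*(x,a^2))$, $(a^+,a^-)=(a^2,a^1)$ otherwise. Let $\hat\theta_{k+1}$ be a minimizer (ties broken arbitrarily) over $\theta\in B_q(0,R)$, where $q=p$ or $q=2$, of $$\sum_{(x,a^+,a^-)}-\ln\sigma\Big(\gamma\ln\tfrac{\pi_\theta(a^+\mid x)}{\pi_\theta(a^-\mid x)}-\gamma\ln\tfrac{\pi_0(a^+\mid x)}{\pi_0(a^-\mid x)}\Big).$$ The output after $T$ rounds is $\hat\theta=\hat\theta_T$. **Statement.** Let $0<c_1\le c_2$. There is $c_0>0$ depending only on $c_1,c_2$; for all $r_0,b>0$ there is $C_1>0$ depending only on $c_1,c_2,r_0,b$; and for all $\eta\in(0,1)$, $\alpha>0$ there is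 $C_2>0$ depending only on $c_1,c_2,r_0,b,\eta,\alpha$, such that the following holds for every setting as above. Assume $c_1/R\le\gamma\le c_2/R$, that $r\mapsto C_*^p(r)/r^{2+\alpha}$ is nondecreasing on $[r_0,\infty)$, and let $\delta\in(0,1)$, $\varepsilon>0$. Let $K$ be the least $k\in\mathbb N=\{0,1,2,\dots\}$ with $\eta^kR<r_0$, put $T=K+1$ and $$\xi_n=\frac{52e^{4\gamma R}d^{2/p}}{\lambda\eta^2n}\ln\frac{9\gamma RTn}{\delta}.$$ Let $n_i,n_f\in\mathbb N$ be such that the two logarithms in $\xi_{n_i},\xi_{n_f}$ are at least $1$ and $$\xi_{n_i}\le \frac{c_0}{C_*^p(R)},\qquad \xi_{n_f}\le b\,\gamma^2\varepsilon^2 .$$ Run on-policy DPO for $T$ rounds with $n_k=\lceil\eta^{\alpha k}n_i\rceil$ for $0\le k<K$ and $n_K=n_f$. Then the number of rounds satisfies $T\le C_2\max(1,\ln R)$, the total number of samples satisfies $\sum_{k=0}^{K}n_k\le C_2n_i+n_f$, and with probability at least $1-\delta$ $$\|\hat\theta-\theta^*\|_p\le C_1\varepsilon .$$ -/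

import Mathlib

open scoped ENNReal NNReal

namespace OnPolicyDPO

noncomputable section

/-- The `ℓ^p` norm of a vector of `ℝ^d`. -/
def lpNorm {d : ℕ} (p : ℝ) (v : Fin d → ℝ) : ℝ :=
  ‖WithLp.toLp (ENNReal.ofReal p) v‖

/-- The closed `ℓ^p` ball `B_p(c, r)` in `ℝ^d`. -/
def lpBall {d : ℕ} (p : ℝ) (c : Fin d → ℝ) (r : ℝ) : Set (Fin d → ℝ) :=
  {v | lpNorm p (v - c) ≤ r}

/-- Exponential tilting of a policy: `tilt π g (a ∣ x) ∝ π (a ∣ x) * exp (g x a)`. -/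
def tilt {X A : Type*} [Fintype A] (π : X → PMF A) (g : X → A → ℝ) (x : X) : PMF A :=
  PMF.normalize (fun a => π x a * ENNReal.ofReal (Real.exp (g x a)))
    (by
      obtain ⟨a, ha⟩ := (π x).support_nonempty
      rw [Ne, ENNReal.tsum_eq_zero]
      intro h
      have h1 := h a
      rw [mul_eq_zero] at h1
      rcases h1 with h1 | h1
      · exact ((π x).mem_support_iff a).1 ha h1
      · rw [ENNReal.ofReal_eq_zero] at h1
        exact absurd h1 (not_le.2 (Real.exp_pos _)))
    (by
      rw [tsum_fintype]
      exact ENNReal.sum_ne_top.2 fun a _ =>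
        ENNReal.mul_ne_top ((π x).apply_ne_top a) ENNReal.ofReal_ne_top)

/-- The linear softmax policy `π_θ (a ∣ x) ∝ π₀ (a ∣ x) * exp (θᵀ φ (x, a))`. -/
def softmaxPolicy {X A : Type*} [Fintype A] {d : ℕ} (π₀ : X → PMF A) (φ : X → A → Fin d → ℝ)
    (θ : Fin d → ℝ) : X → PMF A :=
  tilt π₀ fun x a => θ ⬝ᵥ φ x a

/-- The target policy `π* (a ∣ x) ∝ π₀ (a ∣ x) * exp (r x a / γ)` of the
KL-regularized reward maximization problem with reward `r`. -/
def targetPolicy {X A : Type*} [Fintype A] (π₀ : X → PMF A) (γ : ℝ) (r : X → A → ℝ) :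
    X → PMF A :=
  tilt π₀ fun x a => r x a / γ

/-- The conditional feature mean `E_{a ∼ π(x)} φ (x, a)`. -/
def featureMean {X A : Type*} [Fintype A] {d : ℕ} (φ : X → A → Fin d → ℝ) (π : X → PMF A)
    (x : X) : Fin d → ℝ :=
  ∑ a, (π x a).toReal • φ x a

/-- The feature covariance
`V(π) = E_{x ∼ D, a ∼ π(x)} (φ (x, a) - E_{a ∼ π(x)} φ (x, a))^{⊗ 2}`. -/
def featureCov {X A : Type*} [Fintype X] [Fintype A] {d : ℕ} (D : PMF X)
    (φ : X → A → Fin d → ℝ) (π : X → PMF A) : Matrix (Fin d) (Fin d) ℝ :=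
  ∑ x, (D x).toReal • ∑ a, (π x a).toReal •
    Matrix.vecMulVec (φ x a - featureMean φ π x) (φ x a - featureMean φ π x)

/-- The coverage `C_{π → π'} = inf {C > 0 ∣ V(π') ⪯ C V(π)}` of `π'` by `π`. -/
def coverage {X A : Type*} [Fintype X] [Fintype A] {d : ℕ} (D : PMF X)
    (φ : X → A → Fin d → ℝ) (π π' : X → PMF A) : ℝ :=
  sInf {C : ℝ | 0 < C ∧ (C • featureCov D φ π - featureCov D φ π').PosSemidef}

/-- The local coverage `C_*^p(ρ) = sup {C_{π_θ → π_θs} ∣ θ ∈ B_p(θs, ρ)}`. -/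
def localCoverage {X A : Type*} [Fintype X] [Fintype A] {d : ℕ} (D : PMF X)
    (π₀ : X → PMF A) (φ : X → A → Fin d → ℝ) (p : ℝ) (θs : Fin d → ℝ) (ρ : ℝ) : ℝ :=
  sSup ((fun θ => coverage D φ (softmaxPolicy π₀ φ θ) (softmaxPolicy π₀ φ θs)) '' lpBall p θs ρ)

/-- The law of the answer of the Bradley-Terry oracle for reward difference `z`:
`true` with probability `σ(z)` and `false` with probability `σ(-z) = 1 - σ(z)`. -/
def bradleyTerry (z : ℝ) : PMF Bool :=
  PMF.ofFintype (fun b => ENNReal.ofReal (Real.sigmoid (if b then z else -z))) (by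
    simp only [Fintype.sum_bool, if_true, Bool.false_eq_true, if_false]
    rw [← ENNReal.ofReal_add (Real.sigmoid_nonneg _) (Real.sigmoid_nonneg _), Real.sigmoid_neg]
    simp)

/-- The law of one labelled comparison `(x, a⁺, a⁻)`: `x ∼ D`, then `a¹, a² ∼ π(x)` independently,
and `a¹` is preferred to `a²` with the Bradley-Terry probability `σ (r x a¹ - r x a²)`. -/
def comparisonLaw {X A : Type*} (D : PMF X) (r : X → A → ℝ) (π : X → PMF A) : PMF (X × A × A) :=
  D.bind fun x => (π x).bind fun a₁ => (π x).bind fun a₂ =>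
    (bradleyTerry (r x a₁ - r x a₂)).map fun b => if b then (x, a₁, a₂) else (x, a₂, a₁)

/-- The law of `n` independent draws from `μ`. -/
def iidLaw {Z : Type*} [Fintype Z] (μ : PMF Z) (n : ℕ) : PMF (Fin n → Z) :=
  PMF.ofFintype (fun z => ∏ i, μ (z i)) (by
    classical
    have h : ∑ z, μ z = 1 := (tsum_fintype (fun z => μ z)).symm.trans μ.tsum_coe
    rw [← Fintype.piFinset_univ, ← Finset.prod_univ_sum]
    simp [h])

/-- The DPO objective of the policy `π` on a data set of triples `(x, a⁺, a⁻)`. -/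
def dpoLoss {X A : Type*} (π₀ : X → PMF A) (γ : ℝ) {n : ℕ} (data : Fin n → X × A × A)
    (π : X → PMF A) : ℝ :=
  ∑ i, -Real.log (Real.sigmoid
    (γ * Real.log ((π (data i).1 (data i).2.1).toReal / (π (data i).1 (data i).2.2).toReal)
      - γ * Real.log ((π₀ (data i).1 (data i).2.1).toReal / (π₀ (data i).1 (data i).2.2).toReal)))

/-- `upd k θ data` is the parameter chosen in round `k` with batch size `batch k`, when the current
parameter is `θ` and the batch drawn in this round is `data`. The predicate says that this is always
a minimizer of the DPO objective over `Θ`; ties may be broken in any way. -/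
def IsDPOUpdate {X A : Type*} [Fintype A] {d : ℕ} (π₀ : X → PMF A) (φ : X → A → Fin d → ℝ)
    (γ : ℝ) (Θ : Set (Fin d → ℝ)) (batch : ℕ → ℕ)
    (upd : ∀ k : ℕ, (Fin d → ℝ) → (Fin (batch k) → X × A × A) → Fin d → ℝ) : Prop :=
  ∀ (k : ℕ) (θ : Fin d → ℝ) (data : Fin (batch k) → X × A × A),
    upd k θ data ∈ Θ ∧
      IsMinOn (fun θ' => dpoLoss π₀ γ data (softmaxPolicy π₀ φ θ')) Θ (upd k θ data)

/-- The law of the parameter `θ_k` of on-policy DPO after `k` rounds: `θ_0 = 0` (the base policy),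
and round `k` draws a batch of `batch k` comparisons from the current policy, independently of the
past given `θ_k`, and minimizes the DPO objective of this batch. -/
def dpoLaw {X A : Type*} [Fintype X] [Fintype A] {d : ℕ} (D : PMF X) (π₀ : X → PMF A)
    (φ : X → A → Fin d → ℝ) (r : X → A → ℝ) (batch : ℕ → ℕ)
    (upd : ∀ k : ℕ, (Fin d → ℝ) → (Fin (batch k) → X × A × A) → Fin d → ℝ) :
    ℕ → PMF (Fin d → ℝ)
  | 0 => PMF.pure 0
  | k + 1 => (dpoLaw D π₀ φ r batch upd k).bind fun θ =>
      (iidLaw (comparisonLaw D r (softmaxPolicy π₀ φ θ)) (batch k)).map (upd k θ)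

/-- `ξ_n = 52 e^{4γR} d^{2/p} / (lam η² n) * ln (9 γ R T n / δ)` for `T` rounds. -/
def xi (d : ℕ) (p R γ lam η δ : ℝ) (T n : ℕ) : ℝ :=
  52 * Real.exp (4 * γ * R) * (d : ℝ) ^ (2 / p) / (lam * η ^ 2 * n) *
    Real.log (9 * γ * R * T * n / δ)

/-- The number of rounds with decaying batches: the least `k` with `η ^ k * R < r₀`. -/
def decayRounds (η R r₀ : ℝ) : ℕ :=
  sInf {k : ℕ | η ^ k * R < r₀}

/-- Batch sizes `⌈η^{αk} n_i⌉` in the first `K` rounds `k = 0, …, K - 1`, then `n_f`. -/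
def batchSchedule (η α : ℝ) (K ni nf : ℕ) (k : ℕ) : ℕ :=
  if k < K then ⌈η ^ (α * k) * (ni : ℝ)⌉₊ else nf

end

end OnPolicyDPO

open OnPolicyDPO

/-! Realizability makes every reward difference equal to `γ` times `θs ⬝ᵥ` the feature difference
wherever `π₀` charges both actions (`reward_sub_eq`). The labels thus follow a logistic model with
parameter `θs`, and DPO is constrained maximum likelihood for it, whichever policy samples the
actions.

One round (`iidLaw_dpo_round`): by the Hellinger affinity, the mean square root of the likelihood
ratio of `θ` against `θs` is at most `1 - c γ² V(π)[θ - θs]`. Markov's inequality for the product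
over the samples and a union bound over a grid give `γ² V(π)[θ̂ - θs] ≤ κ d L / n`, where `L` is the
logarithm in `xi`. Coverage transfers this to `V(π*) ⪰ lam`, and comparing norms turns `d` into `d ^
(2 / p)` (`iidLaw_dpo_round_lpNorm`).

All rounds: let the iterate be within `h R` of `θs`, with `h = η ^ k`. The growth assumption bounds
its coverage by `h ^ (2 + α)` times that at radius `R` (`localCoverage_decay`). The smaller batch `h
^ α n_i` uses up `h ^ α`; the remaining `h ^ 2` contracts the radius to `η h R`. Below `r₀` the
coverage is at most `exp (2 r₀)` (`coverage_softmax_le_exp`), so the last batch reaches accuracy `C₁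
ε`. Each round fails with probability at most `δ / T`, and `dpoLaw_compl_le` adds the failures. -/

namespace OnPolicyDPO

/-! ### Comparison of the `ℓ^p` and `ℓ^2` norms. -/

theorem lpNorm_eq_sum {d : ℕ} {p : ℝ} (hp : 0 < p) (v : Fin d → ℝ) :
    lpNorm p v = (∑ i, |v i| ^ p) ^ (1 / p) := by
  have h : (ENNReal.ofReal p).toReal = p := ENNReal.toReal_ofReal hp.le
  rw [lpNorm, PiLp.norm_eq_sum (by rw [h]; exact hp)]
  simp [h]

theorem lpNorm_nonneg {d : ℕ} {p : ℝ} (hp : 0 < p) (v : Fin d → ℝ) : 0 ≤ lpNorm p v := by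
  rw [lpNorm_eq_sum hp]
  exact Real.rpow_nonneg (Finset.sum_nonneg fun i _ => Real.rpow_nonneg (abs_nonneg _) _) _

theorem lpNorm_neg {d : ℕ} {p : ℝ} (hp : 0 < p) (v : Fin d → ℝ) : lpNorm p (-v) = lpNorm p v := by
  simp [lpNorm_eq_sum hp]

theorem lpNorm_two_sq {d : ℕ} (v : Fin d → ℝ) : lpNorm 2 v ^ 2 = ∑ i, v i ^ 2 := by
  rw [lpNorm_eq_sum two_pos, ← Real.sqrt_eq_rpow, Real.sq_sqrt]
  · simp
  · exact Finset.sum_nonneg fun i _ => Real.rpow_nonneg (abs_nonneg _) _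

theorem lpNorm_two_add_le {d : ℕ} (v w : Fin d → ℝ) :
    lpNorm 2 (v + w) ≤ lpNorm 2 v + lpNorm 2 w := by
  have h : ENNReal.ofReal 2 = 2 := by simp
  unfold lpNorm
  rw [h, WithLp.toLp_add]
  exact norm_add_le _ _

theorem lpNorm_two_sub_le {d : ℕ} (v w : Fin d → ℝ) :
    lpNorm 2 (v - w) ≤ lpNorm 2 v + lpNorm 2 w := by
  rw [sub_eq_add_neg, ← lpNorm_neg two_pos w]
  exact lpNorm_two_add_le _ _

theorem abs_dotProduct_le {d : ℕ} (v w : Fin d → ℝ) :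
    |v ⬝ᵥ w| ≤ lpNorm 2 v * lpNorm 2 w := by
  refine abs_le_of_sq_le_sq ?_ (mul_nonneg (lpNorm_nonneg two_pos _) (lpNorm_nonneg two_pos _))
  rw [mul_pow, lpNorm_two_sq, lpNorm_two_sq]
  exact Finset.sum_mul_sq_le_sq_mul_sq _ _ _

/-- Each `|v i|` is at most the `p`-norm, so `v i ^ 2 ≤ |v i| ^ p * lpNorm p v ^ (2 - p)`, and one
sums over `i`. -/
theorem lpNorm_two_le {d : ℕ} {p : ℝ} (hp : 1 ≤ p) (hp2 : p ≤ 2) (v : Fin d → ℝ) :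
    lpNorm 2 v ≤ lpNorm p v := by
  have hp0 : 0 < p := by linarith
  have h0 := lpNorm_nonneg hp0 v
  have key : ∑ i, v i ^ 2 ≤ lpNorm p v ^ 2 := by
    have hs : ∑ i, |v i| ^ p = lpNorm p v ^ p := by
      rw [lpNorm_eq_sum hp0, ← Real.rpow_mul, one_div_mul_cancel hp0.ne', Real.rpow_one]
      exact Finset.sum_nonneg fun i _ => Real.rpow_nonneg (abs_nonneg _) _
    have hle : ∀ i, |v i| ≤ lpNorm p v := fun i => by
      have h1 : |v i| ^ p ≤ lpNorm p v ^ p := by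
        rw [← hs]
        exact Finset.single_le_sum (f := fun i => |v i| ^ p)
          (fun i _ => Real.rpow_nonneg (abs_nonneg _) _) (Finset.mem_univ i)
      exact (Real.rpow_le_rpow_iff (abs_nonneg _) h0 hp0).1 h1
    calc ∑ i, v i ^ 2 ≤ ∑ i, |v i| ^ p * lpNorm p v ^ (2 - p) := by
          apply Finset.sum_le_sum
          intro i _
          have e : v i ^ 2 = |v i| ^ p * |v i| ^ (2 - p) := by
            rw [← Real.rpow_add_of_nonneg (abs_nonneg _) hp0.le (by linarith)]
            simp
          rw [e]
          exact mul_le_mul_of_nonneg_left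
            (Real.rpow_le_rpow (abs_nonneg _) (hle i) (by linarith))
            (Real.rpow_nonneg (abs_nonneg _) _)
      _ = lpNorm p v ^ 2 := by
          rw [← Finset.sum_mul, hs, ← Real.rpow_add_of_nonneg h0 hp0.le (by linarith)]
          simp
  rw [← lpNorm_two_sq] at key
  exact (sq_le_sq₀ (lpNorm_nonneg two_pos v) h0).1 key

/-- Convexity of `t ↦ t ^ (2 / p)` applied to the `|v i| ^ p`. The loss here, times the `d` of the
statistical rate, is the `d ^ (2 / p)` of `xi`. -/
theorem lpNorm_sq_le {d : ℕ} (hd : 0 < d) {p : ℝ} (hp : 1 ≤ p) (hp2 : p ≤ 2) (v : Fin d → ℝ) :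
    lpNorm p v ^ 2 ≤ (d : ℝ) ^ (2 / p - 1) * lpNorm 2 v ^ 2 := by
  have hp0 : 0 < p := by linarith
  have hd' : (0 : ℝ) < d := Nat.cast_pos.2 hd
  have hS : 0 ≤ ∑ i, |v i| ^ p := Finset.sum_nonneg fun i _ => Real.rpow_nonneg (abs_nonneg _) _
  have hq : 1 ≤ 2 / p := by rw [le_div_iff₀ hp0]; linarith
  have hJ := Real.rpow_sum_le_const_mul_sum_rpow (Finset.univ : Finset (Fin d))
    (fun i => |v i| ^ p) hq
  have e1 : lpNorm p v ^ 2 = (∑ i, |v i| ^ p) ^ (2 / p) := by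
    rw [lpNorm_eq_sum hp0, ← Real.rpow_natCast, ← Real.rpow_mul hS]
    congr 1
    push_cast
    ring
  rw [e1, lpNorm_two_sq]
  have e2 : ∀ i, |(|v i| ^ p)| = |v i| ^ p := fun i =>
    abs_of_nonneg (Real.rpow_nonneg (abs_nonneg _) _)
  have e3 : ∀ i, (|v i| ^ p) ^ (2 / p) = v i ^ 2 := fun i => by
    rw [← Real.rpow_mul (abs_nonneg _), mul_div_cancel₀ _ hp0.ne']
    simp
  simpa [e2, e3] using hJ

/-! ### Tilted policies and variance identities. -/

theorem sum_toReal_pmf {A : Type*} [Fintype A] (μ : PMF A) : ∑ a, (μ a).toReal = 1 := by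
  rw [← ENNReal.toReal_sum fun a _ => μ.apply_ne_top a, ← tsum_fintype (L := .unconditional _),
    μ.tsum_coe, ENNReal.toReal_one]

theorem tilt_toReal {X A : Type*} [Fintype A] (π : X → PMF A) (g : X → A → ℝ) (x : X) (a : A) :
    (tilt π g x a).toReal =
      (π x a).toReal * Real.exp (g x a) / ∑ a', (π x a').toReal * Real.exp (g x a') := by
  rw [tilt, PMF.normalize_apply, tsum_fintype, ENNReal.toReal_mul, ENNReal.toReal_inv,
    ENNReal.toReal_sum fun a _ => ENNReal.mul_ne_top ((π x).apply_ne_top a) ENNReal.ofReal_ne_top]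
  simp [ENNReal.toReal_ofReal (Real.exp_pos _).le, div_eq_mul_inv]

theorem tilt_normalizer_pos {X A : Type*} [Fintype A] (π : X → PMF A) (g : X → A → ℝ) (x : X) :
    0 < ∑ a, (π x a).toReal * Real.exp (g x a) := by
  obtain ⟨a, ha⟩ := (π x).support_nonempty
  refine Finset.sum_pos' (fun a _ => by positivity) ⟨a, Finset.mem_univ a, ?_⟩
  exact mul_pos (ENNReal.toReal_pos (((π x).mem_support_iff a).1 ha) ((π x).apply_ne_top a))
    (Real.exp_pos _)

/-- Samples from any iterate stay in the support of `π₀`, where the log-ratios in the loss are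
genuine. -/
theorem tilt_toReal_pos_iff {X A : Type*} [Fintype A] (π : X → PMF A) (g : X → A → ℝ) (x : X)
    (a : A) : 0 < (tilt π g x a).toReal ↔ 0 < (π x a).toReal := by
  rw [tilt_toReal, div_pos_iff_of_pos_right (tilt_normalizer_pos π g x),
    mul_pos_iff_of_pos_right (Real.exp_pos _)]

/-- The log-ratio of a tilted policy, relative to that of the base policy. -/
theorem log_tilt_ratio {X A : Type*} [Fintype A] (π : X → PMF A) (g : X → A → ℝ) (x : X)
    {a b : A} (ha : 0 < (π x a).toReal) (hb : 0 < (π x b).toReal) :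
    Real.log ((tilt π g x a).toReal / (tilt π g x b).toReal)
      - Real.log ((π x a).toReal / (π x b).toReal) = g x a - g x b := by
  have hZ := tilt_normalizer_pos π g x
  rw [tilt_toReal, tilt_toReal, div_div_div_cancel_right₀ hZ.ne', mul_div_mul_comm,
    Real.log_mul (by positivity) (by positivity), ← Real.exp_sub, Real.log_exp]
  ring

theorem sum_mul_sq_sub_eq {A : Type*} [Fintype A] {w f : A → ℝ} (hw : ∑ a, w a = 1) (c : ℝ) :
    ∑ a, w a * (f a - c) ^ 2
      = ∑ a, w a * (f a - ∑ b, w b * f b) ^ 2 + ((∑ b, w b * f b) - c) ^ 2 := by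
  have h : ∀ m : ℝ, ∑ a, w a * (f a - m) ^ 2
      = ∑ a, w a * f a ^ 2 - 2 * m * ∑ b, w b * f b + m ^ 2 := fun m => by
    have : m ^ 2 = ∑ a, w a * m ^ 2 := by rw [← Finset.sum_mul, hw, one_mul]
    rw [this, Finset.mul_sum, ← Finset.sum_sub_distrib, ← Finset.sum_add_distrib]
    exact Finset.sum_congr rfl fun a _ => by ring
  rw [h, h]
  ring

theorem sum_sum_mul_sq_sub_eq {A : Type*} [Fintype A] {w f : A → ℝ} (hw : ∑ a, w a = 1) :
    ∑ a, w a * ∑ b, w b * (f a - f b) ^ 2 = 2 * ∑ a, w a * (f a - ∑ b, w b * f b) ^ 2 := by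
  have h : ∀ a, ∑ b, w b * (f a - f b) ^ 2
      = ∑ b, w b * (f b - ∑ b, w b * f b) ^ 2 + (f a - ∑ b, w b * f b) ^ 2 := fun a => by
    have := sum_mul_sq_sub_eq (f := f) hw (f a)
    rw [show (f a - ∑ b, w b * f b) ^ 2 = ((∑ b, w b * f b) - f a) ^ 2 by ring, ← this]
    exact Finset.sum_congr rfl fun b _ => by ring
  simp_rw [h, mul_add, Finset.sum_add_distrib]
  rw [← Finset.sum_mul, hw]
  ring

theorem dotProduct_featureMean {X A : Type*} [Fintype A] {d : ℕ} (φ : X → A → Fin d → ℝ) (π : X → PMF A) (v : Fin d → ℝ) (x : X) :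
    v ⬝ᵥ featureMean φ π x = ∑ a, (π x a).toReal * (v ⬝ᵥ φ x a) := by
  simp [featureMean, dotProduct_sum, dotProduct_smul]

theorem abs_dotProduct_feature_le {X A : Type*} {d : ℕ} {φ : X → A → Fin d → ℝ}
    (hφ : ∀ x a, lpNorm 2 (φ x a) ≤ 1) (v : Fin d → ℝ) (x : X) (a : A) : |v ⬝ᵥ φ x a| ≤ lpNorm 2 v :=
  (abs_dotProduct_le _ _).trans (mul_le_of_le_one_right (lpNorm_nonneg two_pos v) (hφ x a))

/-! ### Quadratic form of the covariance, and coverage. -/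

section
variable {X A : Type*} [Fintype X] [Fintype A] {d : ℕ}

/-- The quadratic form of the feature covariance. -/
noncomputable def covForm (D : PMF X) (φ : X → A → Fin d → ℝ) (π : X → PMF A)
    (v : Fin d → ℝ) : ℝ :=
  ∑ x, (D x).toReal * ∑ a, (π x a).toReal * (v ⬝ᵥ (φ x a - featureMean φ π x)) ^ 2

theorem dotProduct_featureCov_mulVec (D : PMF X) (φ : X → A → Fin d → ℝ) (π : X → PMF A)
    (v : Fin d → ℝ) : v ⬝ᵥ (featureCov D φ π).mulVec v = covForm D φ π v := by
  simp only [featureCov, covForm, Matrix.sum_mulVec, Matrix.smul_mulVec, dotProduct_sum,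
    dotProduct_smul, smul_eq_mul, Matrix.vecMulVec_mulVec]
  refine Finset.sum_congr rfl fun x _ => ?_
  congr 1
  refine Finset.sum_congr rfl fun a _ => ?_
  congr 1
  rw [dotProduct_comm _ v]
  simp [sq]

theorem featureCov_isHermitian (D : PMF X) (φ : X → A → Fin d → ℝ) (π : X → PMF A) :
    (featureCov D φ π).IsHermitian := by
  ext i j
  simp only [Matrix.conjTranspose_apply, star_trivial, featureCov, Matrix.sum_apply,
    Matrix.smul_apply, Matrix.vecMulVec_apply, smul_eq_mul]
  refine Finset.sum_congr rfl fun x _ => ?_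
  congr 1
  exact Finset.sum_congr rfl fun a _ => by ring

theorem covForm_nonneg (D : PMF X) (φ : X → A → Fin d → ℝ) (π : X → PMF A) (v : Fin d → ℝ) :
    0 ≤ covForm D φ π v := by
  unfold covForm
  positivity

/-- The conditional mean minimizes the second moment about a point. This allows recentring at the
mean of another policy. -/
theorem covForm_le_sum (D : PMF X) (φ : X → A → Fin d → ℝ) (π : X → PMF A) (v : Fin d → ℝ)
    (c : X → ℝ) :
    covForm D φ π v ≤ ∑ x, (D x).toReal * ∑ a, (π x a).toReal * (v ⬝ᵥ φ x a - c x) ^ 2 := by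
  refine Finset.sum_le_sum fun x _ => mul_le_mul_of_nonneg_left ?_ ENNReal.toReal_nonneg
  rw [sum_mul_sq_sub_eq (sum_toReal_pmf (π x)) (c x)]
  simp only [dotProduct_sub, dotProduct_featureMean]
  linarith [sq_nonneg ((∑ a, (π x a).toReal * (v ⬝ᵥ φ x a)) - c x)]

/-- The covariance through the difference of two independent actions. -/
theorem sum_sq_dotProduct_sub (D : PMF X) (φ : X → A → Fin d → ℝ) (π : X → PMF A)
    (v : Fin d → ℝ) :
    ∑ x, (D x).toReal * ∑ a, (π x a).toReal * ∑ b, (π x b).toReal *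
      (v ⬝ᵥ (φ x a - φ x b)) ^ 2 = 2 * covForm D φ π v := by
  rw [covForm, Finset.mul_sum]
  refine Finset.sum_congr rfl fun x _ => ?_
  simp only [dotProduct_sub, dotProduct_featureMean]
  rw [sum_sum_mul_sq_sub_eq (sum_toReal_pmf (π x))]
  ring

theorem covForm_add_le (D : PMF X) (φ : X → A → Fin d → ℝ) (π : X → PMF A) (v w : Fin d → ℝ) :
    covForm D φ π (v + w) ≤ 2 * covForm D φ π v + 2 * covForm D φ π w := by
  unfold covForm
  simp only [Finset.mul_sum, ← Finset.sum_add_distrib]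
  refine Finset.sum_le_sum fun x _ => Finset.sum_le_sum fun a _ => ?_
  rw [add_dotProduct]
  have h : 0 ≤ (D x).toReal * (π x a).toReal := by positivity
  nlinarith [mul_nonneg h (sq_nonneg
    (v ⬝ᵥ (φ x a - featureMean φ π x) - w ⬝ᵥ (φ x a - featureMean φ π x)))]

theorem covForm_le_sq {φ : X → A → Fin d → ℝ} (hφ : ∀ x a, lpNorm 2 (φ x a) ≤ 1) (D : PMF X)
    (π : X → PMF A) (v : Fin d → ℝ) : covForm D φ π v ≤ lpNorm 2 v ^ 2 := by
  refine (covForm_le_sum D φ π v fun _ => 0).trans ?_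
  calc ∑ x, (D x).toReal * ∑ a, (π x a).toReal * (v ⬝ᵥ φ x a - 0) ^ 2
      ≤ ∑ x, (D x).toReal * ∑ a, (π x a).toReal * lpNorm 2 v ^ 2 := by
        refine Finset.sum_le_sum fun x _ => mul_le_mul_of_nonneg_left
          (Finset.sum_le_sum fun a _ => mul_le_mul_of_nonneg_left ?_ ENNReal.toReal_nonneg)
          ENNReal.toReal_nonneg
        have h := abs_dotProduct_feature_le hφ v x a
        rw [sub_zero]
        exact sq_le_sq' (neg_le_of_abs_le h) (le_of_abs_le h)
    _ = lpNorm 2 v ^ 2 := by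
        simp only [← Finset.sum_mul, sum_toReal_pmf, one_mul]

/-- The density ratio of the two policies is at most `exp (2 ρ)`, with `ρ` the distance of the
parameters: one factor `exp ρ` from the weight, one from the normalizer. -/
theorem covForm_softmax_le {φ : X → A → Fin d → ℝ} (hφ : ∀ x a, lpNorm 2 (φ x a) ≤ 1)
    (D : PMF X) (π₀ : X → PMF A) (θ θs v : Fin d → ℝ) :
    covForm D φ (softmaxPolicy π₀ φ θs) v ≤
      Real.exp (2 * lpNorm 2 (θ - θs)) * covForm D φ (softmaxPolicy π₀ φ θ) v := by
  refine (covForm_le_sum D φ _ v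
    fun x => v ⬝ᵥ featureMean φ (softmaxPolicy π₀ φ θ) x).trans ?_
  rw [covForm, Finset.mul_sum]
  refine Finset.sum_le_sum fun x _ => ?_
  rw [mul_left_comm]
  refine mul_le_mul_of_nonneg_left ?_ ENNReal.toReal_nonneg
  rw [Finset.mul_sum]
  refine Finset.sum_le_sum fun a _ => ?_
  rw [← mul_assoc, ← dotProduct_sub]
  refine mul_le_mul_of_nonneg_right ?_ (sq_nonneg _)
  set ρ := lpNorm 2 (θ - θs)
  have hZ := tilt_normalizer_pos π₀ (fun x a => θ ⬝ᵥ φ x a) x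
  have hZs := tilt_normalizer_pos π₀ (fun x a => θs ⬝ᵥ φ x a) x
  have hb : ∀ a, |θ ⬝ᵥ φ x a - θs ⬝ᵥ φ x a| ≤ ρ := fun a => by
    rw [← sub_dotProduct]; exact abs_dotProduct_feature_le hφ _ x a
  rw [softmaxPolicy, softmaxPolicy, tilt_toReal, tilt_toReal, ← mul_div_assoc,
    div_le_div_iff₀ hZs hZ]
  have hZle : ∑ a, (π₀ x a).toReal * Real.exp (θ ⬝ᵥ φ x a)
      ≤ Real.exp ρ * ∑ a, (π₀ x a).toReal * Real.exp (θs ⬝ᵥ φ x a) := by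
    rw [Finset.mul_sum]
    refine Finset.sum_le_sum fun a _ => ?_
    rw [mul_left_comm, ← Real.exp_add]
    gcongr
    linarith [(abs_le.1 (hb a)).2]
  have hn : (π₀ x a).toReal * Real.exp (θs ⬝ᵥ φ x a)
      ≤ (π₀ x a).toReal * (Real.exp ρ * Real.exp (θ ⬝ᵥ φ x a)) := by
    rw [← Real.exp_add]
    gcongr
    linarith [(abs_le.1 (hb a)).1]
  calc _ ≤ ((π₀ x a).toReal * (Real.exp ρ * Real.exp (θ ⬝ᵥ φ x a))) *
        (Real.exp ρ * ∑ a, (π₀ x a).toReal * Real.exp (θs ⬝ᵥ φ x a)) := by gcongr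
    _ = _ := by
        rw [two_mul ρ, Real.exp_add]
        ring

theorem posSemidef_smul_sub_iff (D : PMF X) (φ : X → A → Fin d → ℝ) (π π' : X → PMF A) (C : ℝ) :
    (C • featureCov D φ π - featureCov D φ π').PosSemidef ↔
      ∀ v, covForm D φ π' v ≤ C * covForm D φ π v := by
  rw [Matrix.posSemidef_iff_dotProduct_mulVec]
  have h : ∀ v : Fin d → ℝ, star v ⬝ᵥ (C • featureCov D φ π - featureCov D φ π').mulVec v
      = C * covForm D φ π v - covForm D φ π' v := fun v => by
    rw [Matrix.sub_mulVec, Matrix.smul_mulVec, star_trivial, dotProduct_sub, dotProduct_smul,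
      dotProduct_featureCov_mulVec, dotProduct_featureCov_mulVec, smul_eq_mul]
  simp only [h, sub_nonneg]
  refine and_iff_right ?_
  refine Matrix.IsHermitian.sub ?_ (featureCov_isHermitian D φ π')
  exact (featureCov_isHermitian D φ π).smul (by simp [IsSelfAdjoint])

theorem covForm_ge_of_posSemidef {D : PMF X} {φ : X → A → Fin d → ℝ} {π : X → PMF A} {lam : ℝ}
    (h : (featureCov D φ π - lam • (1 : Matrix (Fin d) (Fin d) ℝ)).PosSemidef) (v : Fin d → ℝ) :
    lam * lpNorm 2 v ^ 2 ≤ covForm D φ π v := by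
  have := (Matrix.posSemidef_iff_dotProduct_mulVec.1 h).2 v
  rw [Matrix.sub_mulVec, Matrix.smul_mulVec, star_trivial, dotProduct_sub, dotProduct_smul,
    dotProduct_featureCov_mulVec, Matrix.one_mulVec, smul_eq_mul, sub_nonneg] at this
  rw [lpNorm_two_sq]
  simpa [dotProduct, sq] using this

theorem coverage_le {D : PMF X} {φ : X → A → Fin d → ℝ} {π π' : X → PMF A} {C : ℝ} (hC : 0 < C)
    (h : ∀ v, covForm D φ π' v ≤ C * covForm D φ π v) : coverage D φ π π' ≤ C :=
  csInf_le ⟨0, fun _ hx => hx.1.le⟩ ⟨hC, (posSemidef_smul_sub_iff D φ π π' C).2 h⟩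

/-- The infimum defining the coverage is attained. Where the form of `π` vanishes, the admissible
`C` forces that of `π'` to vanish; elsewhere one divides by it. -/
theorem covForm_le_coverage_mul {D : PMF X} {φ : X → A → Fin d → ℝ} {π π' : X → PMF A} {C : ℝ}
    (hC : 0 < C) (h : ∀ v, covForm D φ π' v ≤ C * covForm D φ π v) (v : Fin d → ℝ) :
    covForm D φ π' v ≤ coverage D φ π π' * covForm D φ π v := by
  rcases (covForm_nonneg D φ π v).eq_or_lt with h0 | h0
  · have := h v
    rw [← h0, mul_zero] at this ⊢
    exact this
  · rw [← div_le_iff₀ h0]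
    refine le_csInf ⟨C, hC, (posSemidef_smul_sub_iff D φ π π' C).2 h⟩ ?_
    rintro c ⟨-, hc⟩
    rw [div_le_iff₀ h0]
    exact (posSemidef_smul_sub_iff D φ π π' c).1 hc v

theorem coverage_softmax_le_exp {φ : X → A → Fin d → ℝ} (hφ : ∀ x a, lpNorm 2 (φ x a) ≤ 1)
    (D : PMF X) (π₀ : X → PMF A) (θ θs : Fin d → ℝ) :
    coverage D φ (softmaxPolicy π₀ φ θ) (softmaxPolicy π₀ φ θs) ≤
      Real.exp (2 * lpNorm 2 (θ - θs)) :=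
  coverage_le (Real.exp_pos _) (covForm_softmax_le hφ D π₀ θ θs)

theorem covForm_softmax_le_coverage_mul {φ : X → A → Fin d → ℝ}
    (hφ : ∀ x a, lpNorm 2 (φ x a) ≤ 1) (D : PMF X) (π₀ : X → PMF A) (θ θs v : Fin d → ℝ) :
    covForm D φ (softmaxPolicy π₀ φ θs) v ≤
      coverage D φ (softmaxPolicy π₀ φ θ) (softmaxPolicy π₀ φ θs) *
        covForm D φ (softmaxPolicy π₀ φ θ) v :=
  covForm_le_coverage_mul (Real.exp_pos _) (covForm_softmax_le hφ D π₀ θ θs) v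

theorem one_le_coverage_self {D : PMF X} {φ : X → A → Fin d → ℝ} {π : X → PMF A} (v : Fin d → ℝ)
    (hv : 0 < covForm D φ π v) : 1 ≤ coverage D φ π π := by
  have := covForm_le_coverage_mul (D := D) (φ := φ) (π := π) (π' := π) one_pos
    (fun v => (one_mul _).ge) v
  exact (le_mul_iff_one_le_left hv).1 this

end

/-! ### Sigmoid estimates and the Hellinger affinity. -/

/-- `log σ` is 1-Lipschitz. This bounds the cost of rounding the estimator to a grid point. -/
theorem log_sigmoid_sub_abs_le (s t : ℝ) :
    Real.log (Real.sigmoid s) - |t - s| ≤ Real.log (Real.sigmoid t) := by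
  rw [← Real.log_exp |t - s|, ← Real.log_div (Real.sigmoid_pos s).ne' (Real.exp_pos _).ne']
  refine Real.log_le_log (div_pos (Real.sigmoid_pos s) (Real.exp_pos _)) ?_
  rw [Real.sigmoid_def, Real.sigmoid_def, ← one_div, ← one_div, div_div,
    div_le_div_iff_of_pos_left one_pos (by positivity) (by positivity), add_mul, one_mul,
    ← Real.exp_add]
  have h1 : 1 ≤ Real.exp |t - s| := Real.one_le_exp (abs_nonneg _)
  have h2 : Real.exp (-t) ≤ Real.exp (-s + |t - s|) :=
    Real.exp_le_exp.2 (by linarith [neg_abs_le (t - s)])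
  linarith

/-- The derivative `σ(x) σ(-x)` is at least `σ(-B) ^ 2` on `[-B, B]`. -/
theorem sigmoid_sub_ge {B s t : ℝ} (hs : -B ≤ s) (hst : s ≤ t) (ht : t ≤ B) :
    Real.sigmoid (-B) ^ 2 * (t - s) ≤ Real.sigmoid t - Real.sigmoid s := by
  refine Convex.mul_sub_le_image_sub_of_le_deriv (convex_Icc (-B) B)
    continuous_sigmoid.continuousOn differentiable_sigmoid.differentiableOn ?_ s
    ⟨hs, hst.trans ht⟩ t ⟨hs.trans hst, ht⟩ hst
  intro x hx
  have hx := interior_subset hx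
  rw [Real.deriv_sigmoid]; beta_reduce; rw [← Real.sigmoid_neg, sq]
  exact mul_le_mul (Real.sigmoid_le hx.1) (Real.sigmoid_le (neg_le_neg hx.2))
    (Real.sigmoid_nonneg _) (Real.sigmoid_nonneg _)

theorem sq_sigmoid_sub_ge {B s t : ℝ} (hs : |s| ≤ B) (ht : |t| ≤ B) :
    Real.sigmoid (-B) ^ 4 * (t - s) ^ 2 ≤ (Real.sigmoid t - Real.sigmoid s) ^ 2 := by
  wlog h : s ≤ t generalizing s t
  · have := this ht hs (le_of_not_ge h)
    linarith [sub_sq_comm s t, sub_sq_comm (Real.sigmoid s) (Real.sigmoid t)]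
  have h1 := sigmoid_sub_ge (abs_le.1 hs).1 h (abs_le.1 ht).2
  have h2 : 0 ≤ Real.sigmoid (-B) ^ 2 * (t - s) :=
    mul_nonneg (sq_nonneg _) (sub_nonneg.2 h)
  calc _ = (Real.sigmoid (-B) ^ 2 * (t - s)) ^ 2 := by ring
    _ ≤ _ := pow_le_pow_left₀ h2 h1 2

/-- With `u = √x` and `v = √y` the gap to the arithmetic mean is `(u - v) ^ 2 / 2`, while `(x - y) ^
2 = (u - v) ^ 2 (u + v) ^ 2 ≤ 4 (u - v) ^ 2`. -/
theorem sqrt_mul_le {x y : ℝ} (hx : 0 ≤ x) (hx1 : x ≤ 1) (hy : 0 ≤ y) (hy1 : y ≤ 1) :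
    √(x * y) ≤ (x + y) / 2 - (x - y) ^ 2 / 8 := by
  obtain ⟨u, hu, rfl⟩ : ∃ u, 0 ≤ u ∧ u ^ 2 = x := ⟨√x, Real.sqrt_nonneg _, Real.sq_sqrt hx⟩
  obtain ⟨v, hv, rfl⟩ : ∃ u, 0 ≤ u ∧ u ^ 2 = y := ⟨√y, Real.sqrt_nonneg _, Real.sq_sqrt hy⟩
  rw [← mul_pow, Real.sqrt_sq (mul_nonneg hu hv)]
  have hu1 : u ≤ 1 := (sq_le_one_iff₀ hu).1 hx1
  have hv1 : v ≤ 1 := (sq_le_one_iff₀ hv).1 hy1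
  have h : (u + v) ^ 2 ≤ 4 := by nlinarith
  nlinarith [mul_nonneg (sq_nonneg (u - v)) (sub_nonneg.2 h)]

/-- Hellinger affinity of two Bernoulli laws with logits `s` and `t`. -/
theorem sigmoid_affinity_le {B s t : ℝ} (hs : |s| ≤ B) (ht : |t| ≤ B) :
    √(Real.sigmoid t * Real.sigmoid s) + √(Real.sigmoid (-t) * Real.sigmoid (-s)) ≤
      1 - Real.sigmoid (-B) ^ 4 / 4 * (t - s) ^ 2 := by
  have h1 := sqrt_mul_le (Real.sigmoid_nonneg t) (Real.sigmoid_le_one t) (Real.sigmoid_nonneg s)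
    (Real.sigmoid_le_one s)
  have h2 := sqrt_mul_le (Real.sigmoid_nonneg (-t)) (Real.sigmoid_le_one (-t))
    (Real.sigmoid_nonneg (-s)) (Real.sigmoid_le_one (-s))
  have h3 := sq_sigmoid_sub_ge hs ht
  have e : (Real.sigmoid (-t) - Real.sigmoid (-s)) ^ 2 = (Real.sigmoid t - Real.sigmoid s) ^ 2 := by
    rw [Real.sigmoid_neg, Real.sigmoid_neg]; ring
  rw [e] at h2
  have e2 := Real.sigmoid_neg t
  have e3 := Real.sigmoid_neg s
  linarith

/-! ### Expectations under the sampling laws, and Markov's inequality. -/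

theorem sum_toReal_bind_mul {Y Z : Type*} [Fintype Y] [Fintype Z] (μ : PMF Y) (κ : Y → PMF Z)
    (g : Z → ℝ) :
    ∑ z, (μ.bind κ z).toReal * g z = ∑ y, (μ y).toReal * ∑ z, (κ y z).toReal * g z := by
  have h : ∀ z, (μ.bind κ z).toReal = ∑ y, (μ y).toReal * (κ y z).toReal := fun z => by
    rw [PMF.bind_apply, tsum_fintype, ENNReal.toReal_sum fun y _ =>
      ENNReal.mul_ne_top (μ.apply_ne_top y) ((κ y).apply_ne_top z)]
    simp
  simp_rw [h, Finset.sum_mul, Finset.mul_sum]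
  rw [Finset.sum_comm]
  simp_rw [mul_assoc]

theorem sum_toReal_pure_mul {Z : Type*} [Fintype Z] (a : Z) (g : Z → ℝ) :
    ∑ z, (PMF.pure a z).toReal * g z = g a := by
  classical
  rw [Finset.sum_eq_single a (fun b _ hb => by simp [PMF.pure_apply, hb]) (by simp)]
  simp

theorem sum_bradleyTerry_mul (z : ℝ) (g : Bool → ℝ) :
    ∑ b, (bradleyTerry z b).toReal * g b =
      Real.sigmoid z * g true + Real.sigmoid (-z) * g false := by
  simp [bradleyTerry, ENNReal.toReal_ofReal (Real.sigmoid_nonneg _)]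

theorem sum_comparisonLaw_mul {X A : Type*} [Fintype X] [Fintype A] (D : PMF X) (r : X → A → ℝ)
    (π : X → PMF A) (g : X × A × A → ℝ) :
    ∑ z, (comparisonLaw D r π z).toReal * g z =
      ∑ x, (D x).toReal * ∑ a, (π x a).toReal * ∑ b, (π x b).toReal *
        (Real.sigmoid (r x a - r x b) * g (x, a, b)
          + Real.sigmoid (-(r x a - r x b)) * g (x, b, a)) := by
  unfold comparisonLaw PMF.map
  simp only [sum_toReal_bind_mul, Function.comp_apply, sum_toReal_pure_mul, sum_bradleyTerry_mul,
    if_true, Bool.false_eq_true, if_false]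

theorem comparisonLaw_support {X A : Type*} [Fintype X] [Fintype A] {D : PMF X} {r : X → A → ℝ}
    {π : X → PMF A} {z : X × A × A} (hz : comparisonLaw D r π z ≠ 0) :
    0 < (π z.1 z.2.1).toReal ∧ 0 < (π z.1 z.2.2).toReal := by
  rw [← PMF.mem_support_iff, comparisonLaw] at hz
  simp only [PMF.mem_support_bind_iff, PMF.mem_support_map_iff] at hz
  obtain ⟨x, -, a, ha, b, hb, c, -, rfl⟩ := hz
  have ha := ENNReal.toReal_pos ((PMF.mem_support_iff _ _).1 ha) ((π x).apply_ne_top a)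
  have hb := ENNReal.toReal_pos ((PMF.mem_support_iff _ _).1 hb) ((π x).apply_ne_top b)
  cases c
  · exact ⟨hb, ha⟩
  · exact ⟨ha, hb⟩

theorem iidLaw_apply {Z : Type*} [Fintype Z] (μ : PMF Z) (n : ℕ) (z : Fin n → Z) :
    iidLaw μ n z = ∏ i, μ (z i) := rfl

theorem sum_iidLaw_mul_prod {Z : Type*} [Fintype Z] (μ : PMF Z) (n : ℕ) (g : Z → ℝ) :
    ∑ z, (iidLaw μ n z).toReal * ∏ i, g (z i) = (∑ z, (μ z).toReal * g z) ^ n := by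
  classical
  have : ∀ z : Fin n → Z, (iidLaw μ n z).toReal * ∏ i, g (z i) = ∏ i, ((μ (z i)).toReal * g (z i)) :=
    fun z => by rw [iidLaw_apply, ENNReal.toReal_prod, Finset.prod_mul_distrib]
  simp_rw [this]
  rw [← Fintype.piFinset_univ, ← Finset.prod_univ_sum (fun _ => Finset.univ)
    (fun _ z => (μ z).toReal * g z)]
  simp

/-- Markov's inequality. The strict event keeps it true for `c = 0`, where `g` must vanish on the
support. -/
theorem toOuterMeasure_lt_le {Z : Type*} [Fintype Z] (μ : PMF Z) {g : Z → ℝ} (hg : ∀ z, 0 ≤ g z)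
    {c q : ℝ} (hc : 0 ≤ c) (hq : ∑ z, (μ z).toReal * g z ≤ c * q) :
    μ.toOuterMeasure {z | c < g z} ≤ ENNReal.ofReal q := by
  classical
  rcases hc.eq_or_lt with rfl | hc
  · have hz : ∀ z, (μ z).toReal * g z = 0 := fun z => by
      rw [zero_mul] at hq
      have h0 : ∀ z ∈ Finset.univ, 0 ≤ (μ z).toReal * g z :=
        fun z _ => mul_nonneg ENNReal.toReal_nonneg (hg z)
      exact (Finset.sum_eq_zero_iff_of_nonneg h0).1
        (le_antisymm hq (Finset.sum_nonneg h0)) z (Finset.mem_univ z)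
    refine (le_of_eq ?_).trans zero_le
    rw [PMF.toOuterMeasure_apply_eq_zero_iff, Set.disjoint_left]
    intro z hz1 hz2
    exact (mul_pos (ENNReal.toReal_pos ((PMF.mem_support_iff _ _).1 hz1) (μ.apply_ne_top z))
      hz2).ne' (hz z)
  · rw [PMF.toOuterMeasure_apply_fintype]
    have h : ∀ z, Set.indicator {z | c < g z} μ z ≤ ENNReal.ofReal ((μ z).toReal * g z / c) :=
      fun z => by
        by_cases hz : c < g z
        · rw [Set.indicator_of_mem (show z ∈ {z | c < g z} from hz)]
          rw [← ENNReal.ofReal_toReal (μ.apply_ne_top z)]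
          refine ENNReal.ofReal_le_ofReal ?_
          rw [le_div_iff₀ hc, ENNReal.toReal_ofReal ENNReal.toReal_nonneg]
          exact mul_le_mul_of_nonneg_left hz.le ENNReal.toReal_nonneg
        · rw [Set.indicator_of_notMem (show z ∉ {z | c < g z} from hz)]
          exact zero_le
    refine (Finset.sum_le_sum fun z _ => h z).trans ?_
    rw [← ENNReal.ofReal_sum_of_nonneg fun z _ =>
      div_nonneg (mul_nonneg ENNReal.toReal_nonneg (hg z)) hc.le, ← Finset.sum_div]
    refine ENNReal.ofReal_le_ofReal ?_
    rw [div_le_iff₀ hc, mul_comm]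
    exact hq

/-! ### A finite grid for the parameter ball. -/

theorem exists_grid_point {d : ℕ} {R s : ℝ} (hs : 0 < s) {θ : Fin d → ℝ} (hθ : lpNorm 2 θ ≤ R) :
    ∃ z ∈ Fintype.piFinset fun _ : Fin d => Finset.Icc (-⌈R / s⌉) ⌈R / s⌉,
      lpNorm 2 (θ - fun i => s * (z i : ℝ)) ≤ √d * s := by
  have hi : ∀ i, |θ i| ≤ R := fun i => by
    refine le_trans ?_ hθ
    refine abs_le_of_sq_le_sq ?_ (lpNorm_nonneg two_pos θ)
    rw [lpNorm_two_sq]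
    exact Finset.single_le_sum (f := fun i => θ i ^ 2) (fun i _ => sq_nonneg _) (Finset.mem_univ i)
  refine ⟨fun i => ⌊θ i / s⌋, ?_, ?_⟩
  · rw [Fintype.mem_piFinset]
    intro i
    have h := abs_le.1 (hi i)
    rw [Finset.mem_Icc, Int.le_floor]
    constructor
    · push_cast
      have h1 := Int.le_ceil (R / s)
      have h2 : -(R / s) ≤ θ i / s := by
        rw [← neg_div]; exact div_le_div_of_nonneg_right h.1 hs.le
      linarith
    · exact (Int.floor_le_floor (div_le_div_of_nonneg_right h.2 hs.le)).trans
        (Int.floor_le_ceil _)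
  · refine (sq_le_sq₀ (lpNorm_nonneg two_pos _) (by positivity)).1 ?_
    rw [lpNorm_two_sq, mul_pow, Real.sq_sqrt (Nat.cast_nonneg d)]
    calc ∑ i, (θ i - s * (⌊θ i / s⌋ : ℝ)) ^ 2 ≤ ∑ _i : Fin d, s ^ 2 := by
          refine Finset.sum_le_sum fun i _ => ?_
          have h1 := Int.floor_le (θ i / s)
          have h2 := Int.lt_floor_add_one (θ i / s)
          rw [le_div_iff₀ hs] at h1
          rw [div_lt_iff₀ hs] at h2
          exact pow_le_pow_left₀ (by linarith) (by linarith) 2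
      _ = d * s ^ 2 := by simp

theorem card_grid_le {d : ℕ} {R s : ℝ} (hs : 0 < s) (hR : 0 < R) :
    ((Fintype.piFinset fun _ : Fin d => Finset.Icc (-⌈R / s⌉) ⌈R / s⌉).card : ℝ) ≤
      (2 * (R / s) + 3) ^ d := by
  rw [Fintype.card_piFinset_const, Int.card_Icc]
  push_cast
  refine pow_le_pow_left₀ (Nat.cast_nonneg _) ?_ d
  have h0 : 0 ≤ ⌈R / s⌉ := Int.ceil_nonneg (by positivity)
  have h1 : (((⌈R / s⌉ + 1 - -⌈R / s⌉).toNat : ℕ) : ℝ) = ((⌈R / s⌉ + 1 - -⌈R / s⌉ : ℤ) : ℝ) := by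
    rw [← Int.cast_natCast, Int.toNat_of_nonneg (by linarith)]
  rw [h1]
  push_cast
  linarith [Int.ceil_lt_add_one (R / s)]

/-! ### Likelihood ratios and the Chernoff bound. -/

theorem sigmoid_mul_exp_half (s t : ℝ) :
    Real.sigmoid s * Real.exp ((Real.log (Real.sigmoid t) - Real.log (Real.sigmoid s)) / 2) =
      √(Real.sigmoid t * Real.sigmoid s) := by
  have hs := Real.sigmoid_pos s
  have ht := Real.sigmoid_pos t
  symm
  rw [Real.sqrt_eq_iff_mul_self_eq (by positivity) (by positivity), mul_mul_mul_comm,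
    ← Real.exp_add, add_halves, Real.exp_sub, Real.exp_log hs, Real.exp_log ht]
  field_simp

/-- The feature difference of a labelled comparison. -/
def featureDiff {X A : Type*} {d : ℕ} (φ : X → A → Fin d → ℝ) (z : X × A × A) : Fin d → ℝ :=
  φ z.1 z.2.1 - φ z.1 z.2.2

/-- Square root of the likelihood ratio of a labelled comparison. -/
noncomputable def sqrtLikelihoodRatio {X A : Type*} {d : ℕ} (φ : X → A → Fin d → ℝ) (γ : ℝ)
    (θs θ : Fin d → ℝ) (z : X × A × A) : ℝ :=
  Real.exp ((Real.log (Real.sigmoid (γ * (θ ⬝ᵥ featureDiff φ z)))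
    - Real.log (Real.sigmoid (γ * (θs ⬝ᵥ featureDiff φ z)))) / 2)

theorem sqrtLikelihoodRatio_nonneg {X A : Type*} {d : ℕ} (φ : X → A → Fin d → ℝ) (γ : ℝ)
    (θs θ : Fin d → ℝ) (z : X × A × A) : 0 ≤ sqrtLikelihoodRatio φ γ θs θ z :=
  (Real.exp_pos _).le

theorem abs_dotProduct_featureDiff_le {X A : Type*} {d : ℕ} {φ : X → A → Fin d → ℝ}
    (hφ : ∀ x a, lpNorm 2 (φ x a) ≤ 1) (v : Fin d → ℝ) (z : X × A × A) :
    |v ⬝ᵥ featureDiff φ z| ≤ 2 * lpNorm 2 v := by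
  rw [featureDiff, dotProduct_sub]
  refine (abs_sub _ _).trans ?_
  linarith [abs_dotProduct_feature_le hφ v z.1 z.2.1, abs_dotProduct_feature_le hφ v z.1 z.2.2]

section
variable {X A : Type*} [Fintype X] [Fintype A] {d : ℕ}

/-- Averaging over the label gives the affinity of two Bernoulli laws. Averaging the squared logit
gap over two independent actions gives twice the covariance form, which turns the `1 / 4` of the
affinity bound into `1 / 2`. -/
theorem sum_comparisonLaw_sqrtLikelihoodRatio_le {D : PMF X} {φ : X → A → Fin d → ℝ}
    {r : X → A → ℝ} {π : X → PMF A} {γ B : ℝ} {θs θ : Fin d → ℝ}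
    (hr : ∀ x a b, 0 < (π x a).toReal → 0 < (π x b).toReal →
      r x a - r x b = γ * (θs ⬝ᵥ (φ x a - φ x b)))
    (hs : ∀ z, |γ * (θs ⬝ᵥ featureDiff φ z)| ≤ B) (ht : ∀ z, |γ * (θ ⬝ᵥ featureDiff φ z)| ≤ B) :
    ∑ z, (comparisonLaw D r π z).toReal * sqrtLikelihoodRatio φ γ θs θ z ≤
      1 - Real.sigmoid (-B) ^ 4 / 2 * (γ ^ 2 * covForm D φ π (θ - θs)) := by
  set c := Real.sigmoid (-B) ^ 4 / 4
  have hpt : ∀ x a b, (π x a).toReal * ((π x b).toReal *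
      (Real.sigmoid (r x a - r x b) * sqrtLikelihoodRatio φ γ θs θ (x, a, b)
        + Real.sigmoid (-(r x a - r x b)) * sqrtLikelihoodRatio φ γ θs θ (x, b, a))) ≤
      (π x a).toReal * ((π x b).toReal *
        (1 - c * γ ^ 2 * ((θ - θs) ⬝ᵥ (φ x a - φ x b)) ^ 2)) := by
    intro x a b
    -- Pairs of probability zero drop out; `hr` is available only for the others.
    rcases (ENNReal.toReal_nonneg (a := π x a)).eq_or_lt with h | ha
    · rw [← h, zero_mul, zero_mul]
    rcases (ENNReal.toReal_nonneg (a := π x b)).eq_or_lt with h | hb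
    · rw [← h, zero_mul, zero_mul]
    refine mul_le_mul_of_nonneg_left (mul_le_mul_of_nonneg_left ?_ hb.le) ha.le
    have e : ∀ v : Fin d → ℝ, γ * (v ⬝ᵥ featureDiff φ (x, b, a))
        = -(γ * (v ⬝ᵥ featureDiff φ (x, a, b))) := fun v => by
      simp only [featureDiff, dotProduct_sub]; ring
    rw [hr x a b ha hb, sqrtLikelihoodRatio, sqrtLikelihoodRatio, e, e]
    have := sigmoid_affinity_le (hs (x, a, b)) (ht (x, a, b))
    simp only [featureDiff] at this ⊢
    rw [sigmoid_mul_exp_half, sigmoid_mul_exp_half]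
    refine this.trans (le_of_eq ?_)
    rw [sub_dotProduct]
    ring
  rw [sum_comparisonLaw_mul]
  calc _ ≤ ∑ x, (D x).toReal * ∑ a, (π x a).toReal * ∑ b, (π x b).toReal *
        (1 - c * γ ^ 2 * ((θ - θs) ⬝ᵥ (φ x a - φ x b)) ^ 2) := by
        refine Finset.sum_le_sum fun x _ => mul_le_mul_of_nonneg_left ?_ ENNReal.toReal_nonneg
        refine Finset.sum_le_sum fun a _ => ?_
        rw [Finset.mul_sum, Finset.mul_sum]
        exact Finset.sum_le_sum fun b _ => hpt x a b
    _ = 1 - c * γ ^ 2 * ∑ x, (D x).toReal * ∑ a, (π x a).toReal * ∑ b, (π x b).toReal *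
        ((θ - θs) ⬝ᵥ (φ x a - φ x b)) ^ 2 := by
        simp only [mul_sub, mul_one, Finset.sum_sub_distrib, sum_toReal_pmf, Finset.mul_sum]
        congr 1
        refine Finset.sum_congr rfl fun x _ => Finset.sum_congr rfl fun a _ =>
          Finset.sum_congr rfl fun b _ => by ring
    _ = _ := by
        rw [sum_sq_dotProduct_sub]
        ring

theorem sum_comparisonLaw_sqrtLikelihoodRatio_nonneg (D : PMF X) (φ : X → A → Fin d → ℝ)
    (r : X → A → ℝ) (π : X → PMF A) (γ : ℝ) (θs θ : Fin d → ℝ) :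
    0 ≤ ∑ z, (comparisonLaw D r π z).toReal * sqrtLikelihoodRatio φ γ θs θ z :=
  Finset.sum_nonneg fun _ _ =>
    mul_nonneg ENNReal.toReal_nonneg (sqrtLikelihoodRatio_nonneg φ γ θs θ _)

/-- Chernoff bound for the likelihood ratios of finitely many parameters. -/
theorem iidLaw_exists_lt_prod_le {ι : Type*} (F : Finset ι) (val : ι → Fin d → ℝ) (D : PMF X)
    (φ : X → A → Fin d → ℝ) (r : X → A → ℝ) (π : X → PMF A) (γ s : ℝ) (θs : Fin d → ℝ) (n : ℕ) :
    (iidLaw (comparisonLaw D r π) n).toOuterMeasure {data | ∃ i ∈ F,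
      Real.exp s *
        (∑ z, (comparisonLaw D r π z).toReal * sqrtLikelihoodRatio φ γ θs (val i) z) ^ n <
          ∏ j, sqrtLikelihoodRatio φ γ θs (val i) (data j)} ≤
      ENNReal.ofReal (F.card * Real.exp (-s)) := by
  set E : ι → ℝ := fun i =>
    (∑ z, (comparisonLaw D r π z).toReal * sqrtLikelihoodRatio φ γ θs (val i) z) ^ n
  have hsub : {data : Fin n → X × A × A | ∃ i ∈ F,
      Real.exp s * E i < ∏ j, sqrtLikelihoodRatio φ γ θs (val i) (data j)} ⊆
      ⋃ i ∈ F, {data | Real.exp s * E i < ∏ j, sqrtLikelihoodRatio φ γ θs (val i) (data j)} := by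
    rintro data ⟨i, hi, h⟩
    exact Set.mem_biUnion (Finset.mem_coe.2 hi) h
  refine (MeasureTheory.measure_mono hsub).trans
    ((MeasureTheory.measure_biUnion_finset_le F _).trans ?_)
  have hone : ∀ i ∈ F, (iidLaw (comparisonLaw D r π) n).toOuterMeasure
      {data | Real.exp s * E i < ∏ j, sqrtLikelihoodRatio φ γ θs (val i) (data j)} ≤
        ENNReal.ofReal (Real.exp (-s)) := fun i _ => by
    refine toOuterMeasure_lt_le _ (fun z => Finset.prod_nonneg fun j _ =>
      sqrtLikelihoodRatio_nonneg φ γ θs (val i) _)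
      (mul_nonneg (Real.exp_pos _).le
        (pow_nonneg (sum_comparisonLaw_sqrtLikelihoodRatio_nonneg D φ r π γ θs _) n)) ?_
    rw [sum_iidLaw_mul_prod, mul_right_comm, ← Real.exp_add, add_neg_cancel, Real.exp_zero,
      one_mul]
  refine (Finset.sum_le_sum hone).trans (le_of_eq ?_)
  rw [Finset.sum_const, nsmul_eq_mul, ENNReal.ofReal_mul (Nat.cast_nonneg _), ENNReal.ofReal_natCast]

end

section
variable {X A : Type*} [Fintype A] {d : ℕ}

theorem dpoLoss_softmaxPolicy {π₀ : X → PMF A} {n : ℕ} {data : Fin n → X × A × A}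
    (h : ∀ i, 0 < (π₀ (data i).1 (data i).2.1).toReal ∧ 0 < (π₀ (data i).1 (data i).2.2).toReal)
    (φ : X → A → Fin d → ℝ) (γ : ℝ) (θ : Fin d → ℝ) :
    dpoLoss π₀ γ data (softmaxPolicy π₀ φ θ) =
      ∑ i, -Real.log (Real.sigmoid (γ * (θ ⬝ᵥ featureDiff φ (data i)))) := by
  refine Finset.sum_congr rfl fun i _ => ?_
  rw [← mul_sub, softmaxPolicy, log_tilt_ratio π₀ _ _ (h i).1 (h i).2, featureDiff, dotProduct_sub]

/-- At the estimator `θh` the likelihood ratio is at least one. Moving to `θ` changes each logit by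
at most `2 e`, and the square root halves this loss. -/
theorem exp_le_prod_sqrtLikelihoodRatio {π₀ : X → PMF A} {n : ℕ} {data : Fin n → X × A × A}
    {φ : X → A → Fin d → ℝ} {γ e : ℝ} {θs θh θ : Fin d → ℝ} (hφ : ∀ x a, lpNorm 2 (φ x a) ≤ 1)
    (h : ∀ i, 0 < (π₀ (data i).1 (data i).2.1).toReal ∧ 0 < (π₀ (data i).1 (data i).2.2).toReal)
    (hmin : dpoLoss π₀ γ data (softmaxPolicy π₀ φ θh) ≤ dpoLoss π₀ γ data (softmaxPolicy π₀ φ θs))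
    (hγ : 0 ≤ γ) (hθ : γ * lpNorm 2 (θh - θ) ≤ e) :
    Real.exp (-(n * e)) ≤ ∏ i, sqrtLikelihoodRatio φ γ θs θ (data i) := by
  rw [dpoLoss_softmaxPolicy h, dpoLoss_softmaxPolicy h, Finset.sum_neg_distrib,
    Finset.sum_neg_distrib, neg_le_neg_iff] at hmin
  simp only [sqrtLikelihoodRatio]
  rw [← Real.exp_sum, Real.exp_le_exp, ← Finset.sum_div, Finset.sum_sub_distrib]
  have key : ∑ i, Real.log (Real.sigmoid (γ * (θh ⬝ᵥ featureDiff φ (data i)))) - n * (2 * e) ≤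
      ∑ i, Real.log (Real.sigmoid (γ * (θ ⬝ᵥ featureDiff φ (data i)))) := by
    have e1 : (n : ℝ) * (2 * e) = ∑ _i : Fin n, 2 * e := by simp
    rw [e1, ← Finset.sum_sub_distrib]
    refine Finset.sum_le_sum fun i _ => ?_
    refine le_trans ?_ (log_sigmoid_sub_abs_le (γ * (θh ⬝ᵥ featureDiff φ (data i))) _)
    refine sub_le_sub_left ?_ _
    rw [abs_sub_comm, ← mul_sub, ← sub_dotProduct, abs_mul, abs_of_nonneg hγ]
    nlinarith [mul_le_mul_of_nonneg_left (abs_dotProduct_featureDiff_le hφ (θh - θ) (data i)) hγ]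
  linarith

end

/-! ### High-probability bound for one round in covariance form. -/

theorem mul_le_of_exp_le_exp_mul_pow {s e m y : ℝ} {n : ℕ} (hm : 0 ≤ m) (hy : m ≤ 1 - y)
    (h : Real.exp (-e) ≤ Real.exp s * m ^ n) : n * y ≤ s + e := by
  have h1 : m ^ n ≤ Real.exp (-(n * y)) := by
    refine (pow_le_pow_left₀ hm (hy.trans (by linarith [Real.add_one_le_exp (-y)] :
      1 - y ≤ Real.exp (-y))) n).trans (le_of_eq ?_)
    rw [← Real.exp_nat_mul]
    ring_nf
  have h2 := h.trans (mul_le_mul_of_nonneg_left h1 (Real.exp_pos s).le)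
  rw [← Real.exp_add, Real.exp_le_exp] at h2
  linarith

theorem covForm_mul_sq_le {X A : Type*} [Fintype X] [Fintype A] {d : ℕ} {φ : X → A → Fin d → ℝ}
    (hφ : ∀ x a, lpNorm 2 (φ x a) ≤ 1) (D : PMF X) (π : X → PMF A) {γ e : ℝ} (hγ : 0 ≤ γ)
    {v : Fin d → ℝ} (hv : γ * lpNorm 2 v ≤ e) : γ ^ 2 * covForm D φ π v ≤ e ^ 2 := by
  refine (mul_le_mul_of_nonneg_left (covForm_le_sq hφ D π v) (sq_nonneg γ)).trans ?_
  rw [← mul_pow]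
  exact pow_le_pow_left₀ (mul_nonneg hγ (lpNorm_nonneg two_pos v)) hv 2

/-- A maximum likelihood bound in terms of a grid of `(2 * γ * R * N * √d + 3) ^ d` parameters. -/
theorem iidLaw_dpo_minimizer_tail {X A : Type*} [Fintype X] [Fintype A] {d : ℕ} (D : PMF X)
    {π₀ : X → PMF A} {φ : X → A → Fin d → ℝ} {r : X → A → ℝ} {γ R c s : ℝ} {θs : Fin d → ℝ}
    (θ : Fin d → ℝ) {n N : ℕ} (hd : 0 < d) (hφ : ∀ x a, lpNorm 2 (φ x a) ≤ 1) (hγ : 0 < γ)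
    (hR : 0 < R) (hc : γ * R ≤ c) (hn : 0 < n) (hnN : n ≤ N)
    (hr : ∀ x a b, 0 < (π₀ x a).toReal → 0 < (π₀ x b).toReal →
      r x a - r x b = γ * (θs ⬝ᵥ (φ x a - φ x b)))
    (hθs : lpNorm 2 θs ≤ R) (f : (Fin n → X × A × A) → Fin d → ℝ)
    (hf : ∀ data, lpNorm 2 (f data) ≤ R)
    (hmin : ∀ data, dpoLoss π₀ γ data (softmaxPolicy π₀ φ (f data)) ≤
      dpoLoss π₀ γ data (softmaxPolicy π₀ φ θs)) :
    (iidLaw (comparisonLaw D r (softmaxPolicy π₀ φ θ)) n).toOuterMeasure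
      {data | (4 * (s + 1) / Real.sigmoid (-(2 * c + 2)) ^ 4 + 2) / n <
        γ ^ 2 * covForm D φ (softmaxPolicy π₀ φ θ) (f data - θs)} ≤
      ENNReal.ofReal ((2 * (γ * R * N * √d) + 3) ^ d * Real.exp (-s)) := by
  set π := softmaxPolicy π₀ φ θ
  have hn' : (0 : ℝ) < n := Nat.cast_pos.2 hn
  have hN : (0 : ℝ) < N := Nat.cast_pos.2 (hn.trans_le hnN)
  have hnN' : (n : ℝ) ≤ N := Nat.cast_le.2 hnN
  have hn1 : (1 : ℝ) ≤ n := Nat.one_le_cast.2 hn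
  have hsd : 0 < √(d : ℝ) := Real.sqrt_pos.2 (Nat.cast_pos.2 hd)
  -- With this mesh, rounding moves the parameter by at most `1 / (γ N)`, so the whole batch loses
  -- at most `n / N ≤ 1` in the exponent.
  set g : ℝ := 1 / (γ * N * √d)
  have hg : 0 < g := by positivity
  have hRg : R / g = γ * R * N * √d := by
    simp only [g]; field_simp
  have hdg : γ * (√d * g) = 1 / N := by
    simp only [g]; field_simp
  set F := Fintype.piFinset fun _ : Fin d => Finset.Icc (-⌈R / g⌉) ⌈R / g⌉
  have hpos : ∀ x a, 0 < (π x a).toReal ↔ 0 < (π₀ x a).toReal := fun x a =>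
    tilt_toReal_pos_iff π₀ _ x a
  have hr' : ∀ x a b, 0 < (π x a).toReal → 0 < (π x b).toReal →
      r x a - r x b = γ * (θs ⬝ᵥ (φ x a - φ x b)) := fun x a b ha hb =>
    hr x a b ((hpos x a).1 ha) ((hpos x b).1 hb)
  -- A rounded point may leave the ball of radius `R`, whence `c + 1` instead of `c`.
  have hbound : ∀ v : Fin d → ℝ, γ * lpNorm 2 v ≤ c + 1 →
      ∀ z, |γ * (v ⬝ᵥ featureDiff φ z)| ≤ 2 * c + 2 := fun v hv z => by
    rw [abs_mul, abs_of_pos hγ]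
    nlinarith [mul_le_mul_of_nonneg_left (abs_dotProduct_featureDiff_le hφ v z) hγ.le]
  -- The inclusion of events is needed only on the support, which is what makes the log-ratios in
  -- the loss usable.
  refine (PMF.toOuterMeasure_mono _ ?_).trans ((iidLaw_exists_lt_prod_le F
    (fun z i => g * (z i : ℝ)) D φ r π γ s θs n).trans (ENNReal.ofReal_le_ofReal
      (mul_le_mul_of_nonneg_right ((card_grid_le hg hR).trans_eq (by rw [hRg]))
        (Real.exp_pos _).le)))
  rintro data ⟨hbad, hsupp⟩
  by_contra hcon
  simp only [Set.mem_ofPred_eq, not_exists, not_and, not_lt] at hcon hbad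
  refine absurd hbad (not_lt.2 ?_)
  have hdata : ∀ i, 0 < (π₀ (data i).1 (data i).2.1).toReal ∧
      0 < (π₀ (data i).1 (data i).2.2).toReal := fun i => by
    rw [PMF.mem_support_iff, iidLaw_apply, Finset.prod_ne_zero_iff] at hsupp
    have h := comparisonLaw_support (hsupp i (Finset.mem_univ i))
    exact ⟨(hpos _ _).1 h.1, (hpos _ _).1 h.2⟩
  obtain ⟨z, hz, hzd⟩ := exists_grid_point hg (hf data)
  set w : Fin d → ℝ := fun i => g * (z i : ℝ)
  have hw : γ * lpNorm 2 (f data - w) ≤ 1 / N :=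
    (mul_le_mul_of_nonneg_left hzd hγ.le).trans_eq hdg
  have hN1 : 1 / (N : ℝ) ≤ 1 := by
    rw [div_le_one hN]; linarith
  have hwb : γ * lpNorm 2 w ≤ c + 1 := by
    have h := lpNorm_two_sub_le (f data) (f data - w)
    rw [sub_sub_cancel] at h
    nlinarith [mul_le_mul_of_nonneg_left h hγ.le, mul_le_mul_of_nonneg_left (hf data) hγ.le]
  have hsb : γ * lpNorm 2 θs ≤ c + 1 := by
    linarith [mul_le_mul_of_nonneg_left hθs hγ.le]
  have h1 := sum_comparisonLaw_sqrtLikelihoodRatio_le (D := D) hr' (hbound θs hsb) (hbound w hwb)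
  have h2 := (exp_le_prod_sqrtLikelihoodRatio hφ hdata (hmin data) hγ.le hw).trans (hcon z hz)
  have h3 := mul_le_of_exp_le_exp_mul_pow
    (sum_comparisonLaw_sqrtLikelihoodRatio_nonneg D φ r π γ θs w) h1 h2
  have hσ : 0 < Real.sigmoid (-(2 * c + 2)) ^ 4 := pow_pos (Real.sigmoid_pos _) 4
  set σ := Real.sigmoid (-(2 * c + 2)) ^ 4
  have h4 : (n : ℝ) * (1 / N) ≤ 1 := by
    rw [mul_one_div, div_le_one hN]; exact hnN'
  have h5 : n * (γ ^ 2 * covForm D φ π (w - θs)) ≤ 2 * (s + 1) / σ := by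
    rw [le_div_iff₀ hσ]
    nlinarith
  have h6 : n * (γ ^ 2 * covForm D φ π (f data - w)) ≤ 1 := by
    have h7 := covForm_mul_sq_le hφ D π hγ.le hw
    calc (n : ℝ) * (γ ^ 2 * covForm D φ π (f data - w)) ≤ (n : ℝ) * (1 / (N : ℝ)) ^ 2 := by gcongr
      _ = ((n : ℝ) * (1 / N)) * (1 / N) := by ring
      _ ≤ 1 := mul_le_one₀ h4 (by positivity) hN1
  have h8 := covForm_add_le D φ π (w - θs) (f data - w)
  rw [show w - θs + (f data - w) = f data - θs by abel] at h8
  have h9 := mul_le_mul_of_nonneg_left (mul_le_mul_of_nonneg_left h8 (sq_nonneg γ)) hn'.le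
  rw [le_div_iff₀ hn', show 4 * (s + 1) / σ = 2 * (2 * (s + 1) / σ) by ring]
  nlinarith

/-- Let `u` be the argument of the logarithm, `L = log u` and `l = |log c₁|`. The base of the grid
count is at most `4 u N ≤ u ^ 2 / c₁ ≤ exp ((2 + l) L)`. The exponent `(3 + 2 l) d L` leaves `exp
(-(1 + l) d L) ≤ c₁ / u ≤ δ / T`. -/
theorem grid_mul_exp_le {c₁ γ R δ : ℝ} {d N T : ℕ} (hd : 0 < d) (hdN : d ≤ N) (hT : 1 ≤ T)
    (hc₁ : 0 < c₁) (hγR : c₁ ≤ γ * R) (hδ : 0 < δ) (hδ1 : δ < 1)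
    (hu : Real.exp 1 ≤ 9 * γ * R * T * N / δ) :
    (2 * (γ * R * N * √d) + 3) ^ d *
      Real.exp (-((3 + 2 * |Real.log c₁|) * (d * Real.log (9 * γ * R * T * N / δ)))) ≤ δ / T := by
  set u := 9 * γ * R * T * N / δ with hu_def
  have hd1 : (1 : ℝ) ≤ d := Nat.one_le_cast.2 hd
  have hdN' : (d : ℝ) ≤ N := Nat.cast_le.2 hdN
  have hN1 : (1 : ℝ) ≤ N := hd1.trans hdN'
  have hT1 : (1 : ℝ) ≤ T := Nat.one_le_cast.2 hT
  have hg : 0 < γ * R := hc₁.trans_le hγR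
  have hu0 : 0 < u := (Real.exp_pos 1).trans_le hu
  have hu1 : 1 ≤ u := by linarith [Real.add_one_le_exp (1 : ℝ)]
  have hL : 1 ≤ Real.log u := by rwa [Real.le_log_iff_exp_le hu0]
  have huδ : u * δ = 9 * (γ * R) * T * N := by
    rw [hu_def]; field_simp
  have hTN : (N : ℝ) ≤ T * N := le_mul_of_one_le_left (by linarith) hT1
  have hTN2 : (T : ℝ) ≤ T * N := le_mul_of_one_le_right (by linarith) hN1
  have hu2 : u * δ ≤ u := mul_le_of_le_one_right hu0.le hδ1.le
  have hb1 : 9 * (γ * R * N) ≤ u := by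
    nlinarith [mul_le_mul_of_nonneg_left hTN hg.le]
  have hb2 : 9 * (c₁ * N) ≤ u := by
    nlinarith [mul_le_mul_of_nonneg_right hγR (by linarith : (0 : ℝ) ≤ N)]
  have hb3 : c₁ / u ≤ δ / T := by
    rw [div_le_div_iff₀ hu0 (by linarith)]
    have : c₁ * T ≤ γ * R * (T * N) := mul_le_mul hγR hTN2 (by linarith) hg.le
    nlinarith
  set l := |Real.log c₁|
  have hl : 0 ≤ l := abs_nonneg _
  set L := Real.log u
  have huL : u = Real.exp L := (Real.exp_log hu0).symm
  have hlL : l ≤ l * L := le_mul_of_one_le_right hl hL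
  have hbase : 2 * (γ * R * N * √d) + 3 ≤ Real.exp ((2 + l) * L) := by
    have hsq : √(d : ℝ) ≤ N := (Real.sqrt_le_left (by linarith)).2 (by nlinarith)
    have h1 : γ * R * N * √d ≤ γ * R * N * N := by gcongr
    have h2 : 2 * (γ * R * N * √d) + 3 ≤ (4 * u) * N := by nlinarith
    have h3 : (4 * u) * N ≤ u * (u / c₁) := by
      rw [mul_comm 4 u, mul_assoc]
      refine mul_le_mul_of_nonneg_left ?_ hu0.le
      rw [le_div_iff₀ hc₁]
      nlinarith
    have h4 : u * (u / c₁) = Real.exp (L + (L - Real.log c₁)) := by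
      rw [Real.exp_add, Real.exp_sub, Real.exp_log hc₁, ← huL]
    refine h2.trans (h3.trans (h4.trans_le (Real.exp_le_exp.2 ?_)))
    linarith [neg_abs_le (Real.log c₁)]
  calc (2 * (γ * R * N * √d) + 3) ^ d * Real.exp (-((3 + 2 * l) * (d * L)))
      ≤ Real.exp ((2 + l) * L) ^ d * Real.exp (-((3 + 2 * l) * (d * L))) := by gcongr
    _ = Real.exp (-((1 + l) * L * d)) := by
        rw [← Real.exp_nat_mul, ← Real.exp_add]
        ring_nf
    _ ≤ Real.exp (Real.log c₁ - L) := by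
        refine Real.exp_le_exp.2 ?_
        have : (1 + l) * L ≤ (1 + l) * L * d := le_mul_of_one_le_right (by positivity) hd1
        linarith [neg_abs_le (Real.log c₁)]
    _ = c₁ / u := by rw [Real.exp_sub, Real.exp_log hc₁, ← huL]
    _ ≤ δ / T := hb3

/-- The constant in the error bound of a single round. -/
noncomputable def roundConst (c₁ c₂ : ℝ) : ℝ :=
  4 * c₂ ^ 2 + (4 * (4 + 2 * |Real.log c₁|) / Real.sigmoid (-(2 * c₂ + 2)) ^ 4 + 2)

theorem roundConst_pos (c₁ c₂ : ℝ) : 0 < roundConst c₁ c₂ := by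
  have := pow_pos (Real.sigmoid_pos (-(2 * c₂ + 2))) 4
  unfold roundConst
  positivity

/-- `N` is separate from `n` because all the shrinking batches keep the logarithm of the initial
size. -/
theorem iidLaw_dpo_round {X A : Type*} [Fintype X] [Fintype A] {d : ℕ} (D : PMF X)
    {π₀ : X → PMF A} {φ : X → A → Fin d → ℝ} {r : X → A → ℝ} {γ R c₁ c₂ δ : ℝ} {θs : Fin d → ℝ}
    (θ : Fin d → ℝ) {n N T : ℕ} (hd : 0 < d) (hφ : ∀ x a, lpNorm 2 (φ x a) ≤ 1) (hγ : 0 < γ)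
    (hR : 0 < R) (hc₁ : 0 < c₁) (hγR : c₁ ≤ γ * R) (hc : γ * R ≤ c₂) (hn : 0 < n) (hnN : n ≤ N)
    (hr : ∀ x a b, 0 < (π₀ x a).toReal → 0 < (π₀ x b).toReal →
      r x a - r x b = γ * (θs ⬝ᵥ (φ x a - φ x b)))
    (hθs : lpNorm 2 θs ≤ R) (f : (Fin n → X × A × A) → Fin d → ℝ)
    (hf : ∀ data, lpNorm 2 (f data) ≤ R)
    (hmin : ∀ data, dpoLoss π₀ γ data (softmaxPolicy π₀ φ (f data)) ≤
      dpoLoss π₀ γ data (softmaxPolicy π₀ φ θs))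
    (hT : 1 ≤ T) (hδ : 0 < δ) (hδ1 : δ < 1) (hu : Real.exp 1 ≤ 9 * γ * R * T * N / δ) :
    (iidLaw (comparisonLaw D r (softmaxPolicy π₀ φ θ)) n).toOuterMeasure
      {data | roundConst c₁ c₂ * (d * Real.log (9 * γ * R * T * N / δ) / n) <
        γ ^ 2 * covForm D φ (softmaxPolicy π₀ φ θ) (f data - θs)} ≤ ENNReal.ofReal (δ / T) := by
  set L := Real.log (9 * γ * R * T * N / δ) with hL_def
  have hL : 1 ≤ L := by
    rwa [hL_def, Real.le_log_iff_exp_le ((Real.exp_pos 1).trans_le hu)]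
  have hn' : (0 : ℝ) < n := Nat.cast_pos.2 hn
  have hd1 : (1 : ℝ) ≤ d := Nat.one_le_cast.2 hd
  have hdL : 1 ≤ d * L := by nlinarith
  have hσ := pow_pos (Real.sigmoid_pos (-(2 * c₂ + 2))) 4
  rcases le_or_gt d N with hdN | hdN
  · refine le_trans (MeasureTheory.measure_mono ?_) ((iidLaw_dpo_minimizer_tail (s :=
      (3 + 2 * |Real.log c₁|) * (d * L)) D θ hd hφ hγ hR hc hn hnN hr hθs f hf hmin).trans
      (ENNReal.ofReal_le_ofReal (grid_mul_exp_le hd hdN hT hc₁ hγR hδ hδ1 hu)))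
    intro data hdata
    rw [Set.mem_ofPred_eq] at hdata ⊢
    refine lt_of_le_of_lt ?_ hdata
    rw [mul_div_assoc', div_le_div_iff_of_pos_right hn']
    have h1 : 4 * ((3 + 2 * |Real.log c₁|) * (d * L) + 1) / Real.sigmoid (-(2 * c₂ + 2)) ^ 4 ≤
        4 * (4 + 2 * |Real.log c₁|) / Real.sigmoid (-(2 * c₂ + 2)) ^ 4 * (d * L) := by
      rw [div_mul_eq_mul_div, div_le_div_iff_of_pos_right hσ]
      linarith
    rw [roundConst]
    nlinarith [sq_nonneg c₂, mul_nonneg (sq_nonneg c₂) (zero_le_one.trans hdL)]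
  -- If `N < d` the rate `d L / n` exceeds one and the diameter bound `γ ‖f data - θs‖ ≤ 2 c₂`
  -- suffices; this is the term `4 c₂ ^ 2` of `roundConst`.
  · refine le_trans (le_of_eq ?_) zero_le
    refine (congrArg _ (Set.eq_empty_iff_forall_notMem.2 fun data => ?_)).trans
      MeasureTheory.measure_empty
    rw [Set.mem_ofPred_eq, not_lt]
    have hv : γ * lpNorm 2 (f data - θs) ≤ 2 * c₂ := by
      nlinarith [mul_le_mul_of_nonneg_left (lpNorm_two_sub_le (f data) θs) hγ.le,
        mul_le_mul_of_nonneg_left (hf data) hγ.le, mul_le_mul_of_nonneg_left hθs hγ.le]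
    refine (covForm_mul_sq_le hφ D _ hγ.le hv).trans ?_
    have h1 : 1 ≤ d * L / n := by
      rw [one_le_div hn']
      have : (n : ℝ) ≤ d := Nat.cast_le.2 (hnN.trans hdN.le)
      nlinarith
    have h2 : 4 * c₂ ^ 2 ≤ roundConst c₁ c₂ := by
      have : 0 ≤ 4 * (4 + 2 * |Real.log c₁|) / Real.sigmoid (-(2 * c₂ + 2)) ^ 4 + 2 := by
        positivity
      rw [roundConst]
      linarith
    nlinarith [roundConst_pos c₁ c₂]

/-! ### The logistic model, and composition of the rounds. -/

/-- The normalizers of the two tilts cancel in the log-ratio of two actions. -/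
theorem reward_sub_eq {X A : Type*} [Fintype A] {d : ℕ} {π₀ : X → PMF A}
    {φ : X → A → Fin d → ℝ} {r : X → A → ℝ} {γ : ℝ} {θs : Fin d → ℝ} (hγ : 0 < γ)
    (h : targetPolicy π₀ γ r = softmaxPolicy π₀ φ θs) (x : X) (a b : A)
    (ha : 0 < (π₀ x a).toReal) (hb : 0 < (π₀ x b).toReal) :
    r x a - r x b = γ * (θs ⬝ᵥ (φ x a - φ x b)) := by
  have h1 := log_tilt_ratio π₀ (fun x a => r x a / γ) x ha hb
  have h2 := log_tilt_ratio π₀ (fun x a => θs ⬝ᵥ φ x a) x ha hb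
  have h3 : tilt π₀ (fun x a => r x a / γ) = tilt π₀ (fun x a => θs ⬝ᵥ φ x a) := h
  rw [h3, h2, div_sub_div_same, eq_div_iff hγ.ne'] at h1
  rw [dotProduct_sub, ← h1]
  ring

theorem toOuterMeasure_le_one {Z : Type*} (μ : PMF Z) (S : Set Z) : μ.toOuterMeasure S ≤ 1 := by
  rw [PMF.toOuterMeasure_apply, ← μ.tsum_coe]
  exact ENNReal.tsum_le_tsum fun z => Set.indicator_le_self _ _ z

theorem toOuterMeasure_bind_compl_le {Y Z : Type*} (μ : PMF Y) (κ : Y → PMF Z) (S : Set Y)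
    (U : Set Z) (e : ℝ≥0∞) (h : ∀ y ∈ S, (κ y).toOuterMeasure U ≤ e) :
    (μ.bind κ).toOuterMeasure U ≤ μ.toOuterMeasure Sᶜ + e := by
  classical
  rw [PMF.toOuterMeasure_bind_apply, PMF.toOuterMeasure_apply]
  calc ∑' y, μ y * (κ y).toOuterMeasure U ≤ ∑' y, (Sᶜ.indicator μ y + μ y * e) := by
        refine ENNReal.tsum_le_tsum fun y => ?_
        by_cases hy : y ∈ S
        · exact (mul_le_mul_right (h y hy) _).trans le_add_self
        · rw [Set.indicator_of_mem (show y ∈ Sᶜ from hy)]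
          exact (mul_le_of_le_one_right' (toOuterMeasure_le_one _ _)).trans le_self_add
    _ = _ := by rw [ENNReal.tsum_add, ENNReal.tsum_mul_right, μ.tsum_coe, one_mul]

/-- Given the current parameter, the next batch is fresh. A uniform failure bound on the
deterministic set `S k` therefore adds up over the rounds. -/
theorem dpoLaw_compl_le {X A : Type*} [Fintype X] [Fintype A] {d : ℕ} {D : PMF X} {π₀ : X → PMF A}
    {φ : X → A → Fin d → ℝ} {r : X → A → ℝ} {batch : ℕ → ℕ}
    {upd : ∀ k : ℕ, (Fin d → ℝ) → (Fin (batch k) → X × A × A) → Fin d → ℝ}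
    (S : ℕ → Set (Fin d → ℝ)) (e : ℝ≥0∞) (h0 : 0 ∈ S 0) (m : ℕ)
    (h : ∀ k < m, ∀ θ ∈ S k, (iidLaw (comparisonLaw D r (softmaxPolicy π₀ φ θ))
      (batch k)).toOuterMeasure {data | upd k θ data ∉ S (k + 1)} ≤ e) :
    (dpoLaw D π₀ φ r batch upd m).toOuterMeasure (S m)ᶜ ≤ m * e := by
  induction m with
  | zero =>
    rw [dpoLaw, Nat.cast_zero, zero_mul, nonpos_iff_eq_zero, PMF.toOuterMeasure_apply_eq_zero_iff,
      PMF.support_pure, Set.disjoint_singleton_left, Set.mem_compl_iff, not_not]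
    exact h0
  | succ k ih =>
    rw [dpoLaw, Nat.cast_add, Nat.cast_one, add_mul, one_mul]
    refine (toOuterMeasure_bind_compl_le _ _ (S k) _ e fun θ hθ => ?_).trans
      (add_le_add_left (ih fun j hj => h j (hj.trans k.lt_succ_self)) e)
    rw [PMF.toOuterMeasure_map_apply]
    exact h k k.lt_succ_self θ hθ

theorem ofReal_one_sub_le_toOuterMeasure {Z : Type*} (μ : PMF Z) (S : Set Z) {δ : ℝ} (hδ : 0 ≤ δ)
    (h : μ.toOuterMeasure Sᶜ ≤ ENNReal.ofReal δ) :
    ENNReal.ofReal (1 - δ) ≤ μ.toOuterMeasure S := by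
  rw [ENNReal.ofReal_sub _ hδ, ENNReal.ofReal_one, tsub_le_iff_right]
  have h1 : (1 : ℝ≥0∞) = μ.toOuterMeasure (S ∪ Sᶜ) := by
    rw [Set.union_compl_self, PMF.toOuterMeasure_apply, Set.indicator_univ, μ.tsum_coe]
  rw [h1]
  exact (MeasureTheory.measure_union_le _ _).trans (add_le_add_right h _)

/-! ### Number of rounds and total sample size. -/

section decayRounds
variable {η R r₀ : ℝ}

theorem pow_decayRounds_mul_lt (hη1 : η < 1) (hR : 0 < R) (hr₀ : 0 < r₀) :
    η ^ decayRounds η R r₀ * R < r₀ := by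
  have : {k : ℕ | η ^ k * R < r₀}.Nonempty := by
    obtain ⟨k, hk⟩ := exists_pow_lt_of_lt_one (div_pos hr₀ hR) hη1
    exact ⟨k, (lt_div_iff₀ hR).1 hk⟩
  exact Nat.sInf_mem this

theorem le_pow_mul_of_lt_decayRounds {k : ℕ} (hk : k < decayRounds η R r₀) : r₀ ≤ η ^ k * R :=
  not_lt.1 (Nat.notMem_of_lt_sInf hk)

/-- Exponent `K - 1` still satisfies `r₀ ≤ η ^ (K - 1) * R`; take logarithms. -/
theorem decayRounds_le (hη : 0 < η) (hη1 : η < 1) (hR : 0 < R) (hr₀ : 0 < r₀)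
    (hK : 0 < decayRounds η R r₀) :
    r₀ ≤ R ∧ (decayRounds η R r₀ : ℝ) ≤ 1 + Real.log (R / r₀) / -Real.log η := by
  have hl : 0 < -Real.log η := neg_pos.2 (Real.log_neg hη hη1)
  refine ⟨by simpa using le_pow_mul_of_lt_decayRounds hK, ?_⟩
  obtain ⟨m, hm⟩ := Nat.exists_eq_succ_of_ne_zero hK.ne'
  have h := le_pow_mul_of_lt_decayRounds (η := η) (R := R) (r₀ := r₀) (k := m) (by omega)
  have h2 := Real.log_le_log hr₀ h
  rw [Real.log_mul (pow_pos hη m).ne' hR.ne', Real.log_pow] at h2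
  rw [hm, Nat.succ_eq_add_one, Nat.cast_add, Nat.cast_one, add_comm, add_le_add_iff_left,
    le_div_iff₀ hl, Real.log_div hR.ne' hr₀.ne']
  linarith

theorem decayRounds_succ_le (hη : 0 < η) (hη1 : η < 1) (hR : 0 < R) (hr₀ : 0 < r₀) :
    ((decayRounds η R r₀ + 1 : ℕ) : ℝ) ≤
      (2 + (1 + |Real.log r₀|) / -Real.log η) * max 1 (Real.log R) := by
  have hl : 0 < -Real.log η := neg_pos.2 (Real.log_neg hη hη1)
  have hM := le_max_left 1 (Real.log R)
  have hM2 := le_max_right 1 (Real.log R)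
  set M := max 1 (Real.log R)
  have hq : 0 ≤ (1 + |Real.log r₀|) / -Real.log η := by positivity
  push_cast
  rcases Nat.eq_zero_or_pos (decayRounds η R r₀) with h | h
  · rw [h]
    push_cast
    nlinarith
  · have h1 := (decayRounds_le hη hη1 hR hr₀ h).2
    have h2 : Real.log (R / r₀) / -Real.log η ≤ (1 + |Real.log r₀|) / -Real.log η * M := by
      rw [div_mul_eq_mul_div, div_le_div_iff_of_pos_right hl, Real.log_div hR.ne' hr₀.ne']
      nlinarith [neg_abs_le (Real.log r₀), abs_nonneg (Real.log r₀)]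
    linarith

end decayRounds

theorem rpow_mul_natCast_eq {η : ℝ} (hη : 0 < η) (α : ℝ) (k : ℕ) :
    η ^ (α * k) = (η ^ k) ^ α := by
  rw [mul_comm, Real.rpow_mul hη.le, Real.rpow_natCast]

/-- A geometric series; each ceiling adds at most one sample, hence the extra `K`. -/
theorem sum_batchSchedule_le {η α : ℝ} (hη : 0 < η) (hη1 : η < 1) (hα : 0 < α) (K ni nf : ℕ) :
    ((∑ k ∈ Finset.range (K + 1), batchSchedule η α K ni nf k : ℕ) : ℝ) ≤
      ni / (1 - η ^ α) + K + nf := by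
  have hx : 0 < η ^ α := Real.rpow_pos_of_pos hη α
  have hx1 : η ^ α < 1 := Real.rpow_lt_one hη.le hη1 hα
  have hterm : ∀ k ∈ Finset.range K,
      (batchSchedule η α K ni nf k : ℝ) ≤ (η ^ α) ^ k * ni + 1 := fun k hk => by
    rw [batchSchedule, if_pos (Finset.mem_range.1 hk), Real.rpow_mul hη.le, Real.rpow_natCast]
    exact (Nat.ceil_lt_add_one (by positivity)).le
  rw [Finset.sum_range_succ]
  push_cast
  have hlast : batchSchedule η α K ni nf K = nf := if_neg (lt_irrefl K)
  rw [hlast]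
  refine add_le_add_left ((Finset.sum_le_sum hterm).trans ?_) _
  rw [Finset.sum_add_distrib, ← Finset.sum_mul]
  simp only [Finset.sum_const, Finset.card_range, nsmul_eq_mul, mul_one]
  refine add_le_add_left ?_ _
  rw [div_eq_inv_mul]
  refine mul_le_mul_of_nonneg_right ?_ (Nat.cast_nonneg _)
  rw [← tsum_geometric_of_lt_one hx.le hx1]
  exact (summable_geometric_of_lt_one hx.le hx1).sum_le_tsum _ fun k _ => by positivity

/-! ### Lower bounds for `xi`. -/

section xi
variable {d : ℕ} {p R γ lam η δ : ℝ} {T n : ℕ}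

theorem one_le_log_of_exp_one_le {u : ℝ} (h : Real.exp 1 ≤ u) : 1 ≤ Real.log u := by
  rwa [Real.le_log_iff_exp_le ((Real.exp_pos 1).trans_le h)]

theorem div_le_sq_mul_xi (hγR : 0 ≤ γ * R) (hlam : 0 < lam) (hη : 0 < η)
    (hu : Real.exp 1 ≤ 9 * γ * R * T * n / δ) :
    (d : ℝ) ^ (2 / p) * Real.log (9 * γ * R * T * n / δ) / (lam * n) ≤
      η ^ 2 * xi d p R γ lam η δ T n := by
  have hL := one_le_log_of_exp_one_le hu
  set L := Real.log (9 * γ * R * T * n / δ) with hLd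
  have he : 1 ≤ 52 * Real.exp (4 * γ * R) := by
    have : 1 ≤ Real.exp (4 * γ * R) := Real.one_le_exp (by nlinarith)
    linarith
  have hX : 0 ≤ (d : ℝ) ^ (2 / p) * L / (lam * n) := by positivity
  have e : η ^ 2 * xi d p R γ lam η δ T n =
      52 * Real.exp (4 * γ * R) * ((d : ℝ) ^ (2 / p) * L / (lam * n)) := by
    rw [xi, ← hLd]
    field_simp
  rw [e]
  exact le_mul_of_one_le_left hX he

/-- Combined with the upper bound assumed on `xi`, this forces the initial batch to be at least a
multiple of the local coverage. -/
theorem div_natCast_le_xi (hγR : 0 ≤ γ * R) (hlam : 0 < lam) (hlam1 : lam ≤ 1) (hη : 0 < η)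
    (hη1 : η < 1) (hd : 0 < d) (hp : 0 < p) (hn : 0 < n)
    (hu : Real.exp 1 ≤ 9 * γ * R * T * n / δ) :
    52 / (n : ℝ) ≤ xi d p R γ lam η δ T n := by
  have hL := one_le_log_of_exp_one_le hu
  have hn' : (0 : ℝ) < n := Nat.cast_pos.2 hn
  have he : 1 ≤ Real.exp (4 * γ * R) := Real.one_le_exp (by nlinarith)
  have hdp : 1 ≤ (d : ℝ) ^ (2 / p) := Real.one_le_rpow (Nat.one_le_cast.2 hd) (by positivity)
  have hden : lam * η ^ 2 * n ≤ n :=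
    mul_le_of_le_one_left hn'.le (mul_le_one₀ hlam1 (sq_nonneg η) (pow_le_one₀ hη.le hη1.le))
  rw [xi]
  refine le_trans ?_ (le_mul_of_one_le_right (by positivity) hL)
  refine div_le_div₀ (by positivity) ?_ (by positivity) hden
  rw [mul_assoc]
  exact le_mul_of_one_le_right (by norm_num) (one_le_mul_of_one_le_of_one_le he hdp)

end xi

/-! ### Local coverage and one round in the `ℓ^p` norm. -/

section
variable {X A : Type*} [Fintype X] [Fintype A] {d : ℕ} {D : PMF X} {π₀ : X → PMF A}
  {φ : X → A → Fin d → ℝ} {p R : ℝ} {θs : Fin d → ℝ}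

/-- A real supremum of an unbounded set is `0`, so positivity at radius `R` encodes boundedness
there, hence at every smaller radius. -/
theorem coverage_le_localCoverage (h : 0 < localCoverage D π₀ φ p θs R) {ρ : ℝ} (hρ : ρ ≤ R)
    {θ : Fin d → ℝ} (hθ : lpNorm p (θ - θs) ≤ ρ) :
    coverage D φ (softmaxPolicy π₀ φ θ) (softmaxPolicy π₀ φ θs) ≤
      localCoverage D π₀ φ p θs ρ := by
  have hbdd : BddAbove ((fun θ => coverage D φ (softmaxPolicy π₀ φ θ) (softmaxPolicy π₀ φ θs)) ''
      lpBall p θs R) := by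
    by_contra hb
    rw [localCoverage, Real.sSup_of_not_bddAbove hb] at h
    exact lt_irrefl _ h
  exact le_csSup (hbdd.mono (Set.image_mono fun v (hv : lpNorm p (v - θs) ≤ ρ) => hv.trans hρ))
    ⟨θ, hθ, rfl⟩

/-- One round of DPO lands in the ball around `θs` whose radius is dictated by the coverage. -/
theorem iidLaw_dpo_round_lpNorm {r : X → A → ℝ} {γ c₁ c₂ δ lam C ρ : ℝ} {θ : Fin d → ℝ}
    {n N T : ℕ} (hd : 0 < d) (hφ : ∀ x a, lpNorm 2 (φ x a) ≤ 1) (hp : 1 ≤ p) (hp2 : p ≤ 2)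
    (hγ : 0 < γ) (hR : 0 < R) (hc₁ : 0 < c₁) (hγR : c₁ ≤ γ * R) (hc : γ * R ≤ c₂) (hn : 0 < n)
    (hnN : n ≤ N)
    (hr : ∀ x a b, 0 < (π₀ x a).toReal → 0 < (π₀ x b).toReal →
      r x a - r x b = γ * (θs ⬝ᵥ (φ x a - φ x b)))
    (hθs : lpNorm 2 θs ≤ R) (f : (Fin n → X × A × A) → Fin d → ℝ)
    (hf : ∀ data, lpNorm 2 (f data) ≤ R)
    (hmin : ∀ data, dpoLoss π₀ γ data (softmaxPolicy π₀ φ (f data)) ≤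
      dpoLoss π₀ γ data (softmaxPolicy π₀ φ θs))
    (hT : 1 ≤ T) (hδ : 0 < δ) (hδ1 : δ < 1) (hu : Real.exp 1 ≤ 9 * γ * R * T * N / δ)
    (hlam : 0 < lam)
    (hcov : ∀ v, lam * lpNorm 2 v ^ 2 ≤ covForm D φ (softmaxPolicy π₀ φ θs) v)
    (hC : coverage D φ (softmaxPolicy π₀ φ θ) (softmaxPolicy π₀ φ θs) ≤ C) (hC0 : 0 ≤ C)
    (hρ : 0 ≤ ρ)
    (hbound : C * (roundConst c₁ c₂ * ((d : ℝ) ^ (2 / p) *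
      Real.log (9 * γ * R * T * N / δ) / (lam * n))) ≤ (γ * ρ) ^ 2) :
    (iidLaw (comparisonLaw D r (softmaxPolicy π₀ φ θ)) n).toOuterMeasure
      {data | ¬ lpNorm p (f data - θs) ≤ ρ} ≤ ENNReal.ofReal (δ / T) := by
  refine (MeasureTheory.measure_mono ?_).trans (iidLaw_dpo_round D θ hd hφ hγ hR hc₁ hγR hc hn hnN
    hr hθs f hf hmin hT hδ hδ1 hu)
  intro data
  rw [Set.mem_ofPred_eq, Set.mem_ofPred_eq]
  contrapose!
  intro h
  set L := Real.log (9 * γ * R * T * N / δ)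
  set v := f data - θs
  have hd' : (0 : ℝ) < d := Nat.cast_pos.2 hd
  have hn' : (0 : ℝ) < n := Nat.cast_pos.2 hn
  have h1 : lam * lpNorm 2 v ^ 2 ≤ C * covForm D φ (softmaxPolicy π₀ φ θ) v :=
    (hcov v).trans ((covForm_softmax_le_coverage_mul hφ D π₀ θ θs v).trans
      (mul_le_mul_of_nonneg_right hC (covForm_nonneg D φ _ v)))
  have h2 : γ ^ 2 * (lam * lpNorm 2 v ^ 2) ≤ C * (roundConst c₁ c₂ * (d * L / n)) := by
    have := mul_le_mul_of_nonneg_left h1 (sq_nonneg γ)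
    have := mul_le_mul_of_nonneg_left h hC0
    linarith
  have hdp : (d : ℝ) ^ (2 / p) = (d : ℝ) ^ (2 / p - 1) * d := by
    rw [Real.rpow_sub_one hd'.ne', div_mul_cancel₀ _ hd'.ne']
  have hx : 0 ≤ (d : ℝ) ^ (2 / p - 1) := by positivity
  have h3 : (γ * lpNorm p v) ^ 2 ≤ (γ * ρ) ^ 2 := by
    refine le_trans ?_ hbound
    calc (γ * lpNorm p v) ^ 2 ≤ γ ^ 2 * ((d : ℝ) ^ (2 / p - 1) * lpNorm 2 v ^ 2) := by
          rw [mul_pow]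
          exact mul_le_mul_of_nonneg_left (lpNorm_sq_le hd hp hp2 v) (sq_nonneg γ)
      _ = (d : ℝ) ^ (2 / p - 1) / lam * (γ ^ 2 * (lam * lpNorm 2 v ^ 2)) := by field_simp
      _ ≤ (d : ℝ) ^ (2 / p - 1) / lam * (C * (roundConst c₁ c₂ * (d * L / n))) :=
          mul_le_mul_of_nonneg_left h2 (by positivity)
      _ = _ := by
          rw [hdp]
          field_simp
  exact le_of_mul_le_mul_left ((sq_le_sq₀ (mul_nonneg hγ.le
    (lpNorm_nonneg (by linarith) v)) (mul_nonneg hγ.le hρ)).1 h3) hγ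

end

theorem localCoverage_decay {X A : Type*} [Fintype X] [Fintype A] {d : ℕ} {D : PMF X}
    {π₀ : X → PMF A} {φ : X → A → Fin d → ℝ} {p R r₀ α h : ℝ} {θs : Fin d → ℝ}
    (hmono : MonotoneOn (fun ρ => localCoverage D π₀ φ p θs ρ / ρ ^ (2 + α)) (Set.Ici r₀))
    (hR : 0 < R) (hh : 0 < h) (hh1 : h ≤ 1) (hr : r₀ ≤ h * R) :
    localCoverage D π₀ φ p θs (h * R) ≤ localCoverage D π₀ φ p θs R * (h ^ 2 * h ^ α) := by
  have hle : h * R ≤ R := mul_le_of_le_one_left hR.le hh1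
  have := hmono (Set.mem_Ici.2 hr) (Set.mem_Ici.2 (hr.trans hle)) hle
  have hRp : 0 < R ^ (2 + α) := Real.rpow_pos_of_pos hR _
  have hhp : 0 < (h * R) ^ (2 + α) := Real.rpow_pos_of_pos (mul_pos hh hR) _
  simp only at this
  rw [div_le_div_iff₀ hhp hRp, Real.mul_rpow hh.le hR.le, Real.rpow_add hh, Real.rpow_two,
    ← mul_assoc, mul_le_mul_iff_left₀ hRp] at this
  exact this

theorem exists_lpNorm_two_eq_one {d : ℕ} (hd : 0 < d) : ∃ v : Fin d → ℝ, lpNorm 2 v = 1 := by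
  refine ⟨Pi.single ⟨0, hd⟩ 1, ?_⟩
  have h : lpNorm 2 (Pi.single (⟨0, hd⟩ : Fin d) (1 : ℝ)) ^ 2 = 1 := by
    rw [lpNorm_two_sq, Finset.sum_eq_single ⟨0, hd⟩ (fun b _ hb => by simp [hb]) (by simp)]
    simp
  exact (pow_eq_one_iff_of_nonneg (lpNorm_nonneg two_pos _) two_ne_zero).1 h

theorem lpNorm_zero {d : ℕ} {p : ℝ} (hp : 0 < p) : lpNorm p (0 : Fin d → ℝ) = 0 := by
  simp [lpNorm_eq_sum hp, Real.zero_rpow hp.ne', Real.zero_rpow (inv_ne_zero hp.ne')]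

/-- The coverage at radius `R` grows at least linearly in `R`. -/
theorem div_le_localCoverage {X A : Type*} [Fintype X] [Fintype A] {d : ℕ} {D : PMF X}
    {π₀ : X → PMF A} {φ : X → A → Fin d → ℝ} {p R r₀ α : ℝ} {θs v : Fin d → ℝ} (hp : 0 < p)
    (hmono : MonotoneOn (fun ρ => localCoverage D π₀ φ p θs ρ / ρ ^ (2 + α)) (Set.Ici r₀))
    (hr₀ : 0 < r₀) (hα : 0 < α) (hr : r₀ ≤ R) (hpos : 0 < localCoverage D π₀ φ p θs R)
    (hv : 0 < covForm D φ (softmaxPolicy π₀ φ θs) v) :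
    R / r₀ ≤ localCoverage D π₀ φ p θs R := by
  -- The centre `θs` lies in the ball, and a policy with nonzero covariance covers itself with
  -- constant at least one.
  have h1 : 1 ≤ localCoverage D π₀ φ p θs r₀ := (one_le_coverage_self v hv).trans
    (coverage_le_localCoverage hpos hr (by rw [sub_self, lpNorm_zero hp]; exact hr₀.le))
  have h2 := hmono (Set.mem_Ici.2 le_rfl) (Set.mem_Ici.2 hr) hr
  have hR : 0 < R := hr₀.trans_le hr
  have hq : 1 ≤ R / r₀ := (one_le_div hr₀).2 hr
  simp only at h2
  rw [div_le_div_iff₀ (Real.rpow_pos_of_pos hr₀ _) (Real.rpow_pos_of_pos hR _)] at h2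
  have h3 : R / r₀ ≤ (R / r₀) ^ (2 + α) := by
    simpa using Real.rpow_le_rpow_of_exponent_le hq (by linarith : (1 : ℝ) ≤ 2 + α)
  refine h3.trans ?_
  rw [Real.div_rpow hR.le hr₀.le, div_le_iff₀ (Real.rpow_pos_of_pos hr₀ _)]
  exact (le_mul_of_one_le_left (Real.rpow_nonneg hR.le _) h1).trans h2

end OnPolicyDPO

/-! ### Assembly of the rounds. -/

theorem mainTheorem8 (c₁ c₂ : ℝ) (hc₁ : 0 < c₁) (hc : c₁ ≤ c₂) :
    ∃ c₀ : ℝ, 0 < c₀ ∧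
    ∀ r₀ b : ℝ, 0 < r₀ → 0 < b →
    ∃ C₁ : ℝ, 0 < C₁ ∧
    ∀ η α : ℝ, 0 < η → η < 1 → 0 < α →
    ∃ C₂ : ℝ, 0 < C₂ ∧
    ∀ (X A : Type*) [Fintype X] [Fintype A] (d : ℕ) (D : PMF X) (π₀ : X → PMF A)
      (φ : X → A → Fin d → ℝ) (r : X → A → ℝ) (p q R γ lam δ ε : ℝ) (θs : Fin d → ℝ)
      (ni nf K : ℕ),
      0 < d →
      (∀ x a, lpNorm 2 (φ x a) ≤ 1) →
      1 ≤ p → p ≤ 2 → (q = p ∨ q = 2) →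
      0 < R → c₁ / R ≤ γ → γ ≤ c₂ / R →
      0 < lam → 0 < δ → δ < 1 → 0 < ε →
      -- realizability of the target policy
      θs ∈ lpBall p 0 R →
      targetPolicy π₀ γ r = softmaxPolicy π₀ φ θs →
      (featureCov D φ (targetPolicy π₀ γ r) - lam • (1 : Matrix (Fin d) (Fin d) ℝ)).PosSemidef →
      -- super-quadratic local coverage
      MonotoneOn (fun ρ => localCoverage D π₀ φ p θs ρ / ρ ^ (2 + α)) (Set.Ici r₀) →
      K = decayRounds η R r₀ →
      -- batch size conditions
      Real.exp 1 ≤ 9 * γ * R * (K + 1 : ℕ) * ni / δ →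
      xi d p R γ lam η δ (K + 1) ni ≤ c₀ / localCoverage D π₀ φ p θs R →
      Real.exp 1 ≤ 9 * γ * R * (K + 1 : ℕ) * nf / δ →
      xi d p R γ lam η δ (K + 1) nf ≤ b * (γ ^ 2 * ε ^ 2) →
      -- number of rounds, total sample cost, and accuracy of the output
      ((K + 1 : ℕ) : ℝ) ≤ C₂ * max 1 (Real.log R) ∧
      ((∑ k ∈ Finset.range (K + 1), batchSchedule η α K ni nf k : ℕ) : ℝ) ≤ C₂ * ni + nf ∧
      ∀ upd : ∀ k : ℕ, (Fin d → ℝ) →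
          (Fin (batchSchedule η α K ni nf k) → X × A × A) → Fin d → ℝ,
        IsDPOUpdate π₀ φ γ (lpBall q 0 R) (batchSchedule η α K ni nf) upd →
        ENNReal.ofReal (1 - δ) ≤
          (dpoLaw D π₀ φ r (batchSchedule η α K ni nf) upd (K + 1)).toOuterMeasure
            {θ | lpNorm p (θ - θs) ≤ C₁ * ε} := by
  set κ := roundConst c₁ c₂ with hκ_def
  have hκ : 0 < κ := roundConst_pos c₁ c₂
  -- Chosen so that `κ` times coverage times `xi` is at most `c₁ ^ 2 ≤ (γ R) ^ 2`.
  refine ⟨c₁ ^ 2 / κ, by positivity, fun r₀ b hr₀ hb => ?_⟩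
  -- The square is coverage below `r₀`, times the round constant, times the accuracy factor of the
  -- last batch.
  refine ⟨√(Real.exp (2 * r₀) * κ * b), by positivity, fun η α hη hη1 hα => ?_⟩
  have hl : 0 < -Real.log η := neg_pos.2 (Real.log_neg hη hη1)
  have hx1 : 0 < 1 - η ^ α := sub_pos.2 (Real.rpow_lt_one hη.le hη1 hα)
  -- The summands pay for the number of rounds, the geometric series, and the rounding of the
  -- batches.
  refine ⟨(2 + (1 + |Real.log r₀|) / -Real.log η) + 1 / (1 - η ^ α) +
    (1 + c₁ ^ 2 / κ / 52 / -Real.log η), by positivity, ?_⟩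
  intro X A _ _ d D π₀ φ r p q R γ lam δ ε θs ni nf K hd hφ hp hp2 hq hR hγ1 hγ2 hlam hδ hδ1 hε
    hθs hreal hcov hmono hK hui hxi huf hxf
  rw [hreal] at hcov
  have hp0 : 0 < p := by linarith
  have hγ : 0 < γ := (div_pos hc₁ hR).trans_le hγ1
  have hγR1 : c₁ ≤ γ * R := (div_le_iff₀ hR).1 hγ1
  have hγR2 : γ * R ≤ c₂ := (le_div_iff₀ hR).1 hγ2
  have hγR : 0 ≤ γ * R := hc₁.le.trans hγR1
  have hθsp : lpNorm p θs ≤ R := by simpa [lpBall] using hθs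
  have hθs2 : lpNorm 2 θs ≤ R := (lpNorm_two_le hp hp2 θs).trans hθsp
  have hpos_of : ∀ n : ℕ, Real.exp 1 ≤ 9 * γ * R * (K + 1 : ℕ) * n / δ → 0 < n := fun n h => by
    rcases Nat.eq_zero_or_pos n with rfl | hn
    · rw [Nat.cast_zero, mul_zero, zero_div] at h
      exact absurd h (not_le.2 (Real.exp_pos 1))
    · exact hn
  have hni := hpos_of ni hui
  have hnf := hpos_of nf huf
  have hni' : (0 : ℝ) < ni := Nat.cast_pos.2 hni
  have hcovf := covForm_ge_of_posSemidef hcov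
  obtain ⟨e, he⟩ := exists_lpNorm_two_eq_one hd
  have hcove := hcovf e
  rw [he, one_pow, mul_one] at hcove
  have hlam1 : lam ≤ 1 := hcove.trans (by simpa [he] using covForm_le_sq hφ D _ e)
  have hxilow := div_natCast_le_xi (p := p) hγR hlam hlam1 hη hη1 hd hp0 hni hui
  -- Otherwise `c₀ / localCoverage ≤ 0` (division by zero gives `0`), against the positive lower
  -- bound on `xi`.
  have hLC : 0 < localCoverage D π₀ φ p θs R := by
    by_contra hneg
    have h1 : c₁ ^ 2 / κ / localCoverage D π₀ φ p θs R ≤ 0 :=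
      div_nonpos_of_nonneg_of_nonpos (by positivity) (not_lt.1 hneg)
    have h2 : 0 < 52 / (ni : ℝ) := by positivity
    linarith
  have hxiLC : localCoverage D π₀ φ p θs R * xi d p R γ lam η δ (K + 1) ni ≤ c₁ ^ 2 / κ := by
    rw [mul_comm]
    exact (le_div_iff₀ hLC).1 hxi
  refine ⟨?_, ?_, ?_⟩
  · have h1 := decayRounds_succ_le hη hη1 hR hr₀
    rw [← hK] at h1
    refine h1.trans (mul_le_mul_of_nonneg_right ?_ (zero_le_one.trans (le_max_left _ _)))
    rw [add_assoc]
    exact le_add_of_nonneg_right (by positivity)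
  · have h1 := sum_batchSchedule_le hη hη1 hα K ni nf
    -- The rounding cost is absorbed by `K ≲ 1 + log (R / r₀)` and `log (R / r₀) ≤ R / r₀ ≤
    -- localCoverage ≲ ni`.
    have hKn : (K : ℝ) ≤ (1 + c₁ ^ 2 / κ / 52 / -Real.log η) * ni := by
      rcases Nat.eq_zero_or_pos K with h0 | h0
      · rw [h0, Nat.cast_zero]
        positivity
      · rw [hK] at h0
        obtain ⟨hrR, h2⟩ := decayRounds_le hη hη1 hR hr₀ h0
        rw [← hK] at h2
        have h3 := div_le_localCoverage hp0 hmono hr₀ hα hrR hLC (hlam.trans_le hcove)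
        have h4 : Real.log (R / r₀) ≤ R / r₀ := Real.log_le_self (by positivity)
        have h5 : localCoverage D π₀ φ p θs R ≤ c₁ ^ 2 / κ / 52 * ni := by
          have := (mul_le_mul_of_nonneg_left hxilow hLC.le).trans hxiLC
          rw [mul_div_assoc', div_le_iff₀ hni'] at this
          linarith
        have h6 : Real.log (R / r₀) / -Real.log η ≤ c₁ ^ 2 / κ / 52 / -Real.log η * ni := by
          rw [div_mul_eq_mul_div, div_le_div_iff_of_pos_right hl]
          exact h4.trans (h3.trans h5)
        have h7 : (1 : ℝ) ≤ ni := Nat.one_le_cast.2 hni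
        linarith
    have h8 : 0 ≤ (2 + (1 + |Real.log r₀|) / -Real.log η) * ni := by positivity
    rw [div_eq_mul_one_div, mul_comm (ni : ℝ)] at h1
    linarith
  · intro upd hupd
    -- The constraint set enters only by lying in the `ℓ^2` ball of radius `R` and containing `θs`;
    -- both choices of `q` qualify.
    have hq2 : ∀ v : Fin d → ℝ, v ∈ lpBall q 0 R → lpNorm 2 v ≤ R := fun v hv => by
      have hv : lpNorm q v ≤ R := by simpa [lpBall] using hv
      rcases hq with rfl | rfl
      · exact (lpNorm_two_le hp hp2 v).trans hv
      · exact hv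
    have hθsq : θs ∈ lpBall q 0 R := by
      rcases hq with rfl | rfl
      · exact hθs
      · simpa [lpBall] using hθs2
    have hbest : ∀ k θ data, lpNorm 2 (upd k θ data) ≤ R := fun k θ data =>
      hq2 _ (hupd k θ data).1
    have hmin : ∀ k θ data, dpoLoss π₀ γ data (softmaxPolicy π₀ φ (upd k θ data)) ≤
        dpoLoss π₀ γ data (softmaxPolicy π₀ φ θs) := fun k θ data => (hupd k θ data).2 hθsq
    have hr := reward_sub_eq hγ hreal
    set C₁ := √(Real.exp (2 * r₀) * κ * b) with hC₁
    -- The radius shrinks geometrically up to index `K`, where it is below `r₀`; the last round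
    -- leads to index `K + 1`.
    set S : ℕ → Set (Fin d → ℝ) := fun k =>
      {θ | lpNorm p (θ - θs) ≤ if k ≤ K then η ^ k * R else C₁ * ε} with hS
    have hround : ∀ k < K + 1, ∀ θ ∈ S k,
        (iidLaw (comparisonLaw D r (softmaxPolicy π₀ φ θ))
          (batchSchedule η α K ni nf k)).toOuterMeasure {data | upd k θ data ∉ S (k + 1)} ≤
          ENNReal.ofReal (δ / (K + 1 : ℕ)) := by
      intro k hk θ hθ
      have hkK : k ≤ K := Nat.lt_succ_iff.1 hk
      have hθk : lpNorm p (θ - θs) ≤ η ^ k * R := by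
        have := hθ
        rwa [hS, Set.mem_ofPred_eq, if_pos hkK] at this
      rcases hkK.lt_or_eq with hlt | heq
      · have hh : 0 < η ^ k := pow_pos hη k
        have hh1 : η ^ k ≤ 1 := pow_le_one₀ hη.le hη1.le
        have hhα : 0 < (η ^ k) ^ α := Real.rpow_pos_of_pos hh α
        have hb_eq : batchSchedule η α K ni nf k = ⌈(η ^ k) ^ α * (ni : ℝ)⌉₊ := by
          rw [batchSchedule, if_pos hlt, rpow_mul_natCast_eq hη]
        have hnk : 0 < batchSchedule η α K ni nf k := by
          rw [hb_eq]; exact Nat.ceil_pos.2 (mul_pos hhα hni')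
        have hnk_le : batchSchedule η α K ni nf k ≤ ni := by
          rw [hb_eq]
          exact Nat.ceil_le.2 (mul_le_of_le_one_left hni'.le (Real.rpow_le_one hh.le hh1 hα.le))
        have hnk_ge : (η ^ k) ^ α * (ni : ℝ) ≤ batchSchedule η α K ni nf k := by
          rw [hb_eq]; exact Nat.le_ceil _
        have hr₀k : r₀ ≤ η ^ k * R := by
          rw [hK] at hlt
          exact le_pow_mul_of_lt_decayRounds hlt
        have hdec := localCoverage_decay hmono hR hh hh1 hr₀k
        have hcovk := (coverage_le_localCoverage hLC (mul_le_of_le_one_left hR.le hh1) hθk).trans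
          hdec
        have hgoal := iidLaw_dpo_round_lpNorm (D := D) (ρ := η ^ (k + 1) * R) hd hφ hp hp2 hγ hR
          hc₁ hγR1 hγR2 hnk hnk_le hr hθs2 (upd k θ) (hbest k θ) (hmin k θ) (Nat.le_add_left 1 K)
          hδ hδ1 hui hlam hcovf hcovk (by positivity) (by positivity) ?_
        · simpa only [hS, Set.mem_ofPred_eq, if_pos (Nat.succ_le_of_lt hlt)] using hgoal
        · have hL := one_le_log_of_exp_one_le hui
          have hxi2 := div_le_sq_mul_xi (d := d) (p := p) hγR hlam hη hui
          set L := Real.log (9 * γ * R * (K + 1 : ℕ) * ni / δ)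
          set Cs := localCoverage D π₀ φ p θs R
          set h := η ^ k
          set n := (batchSchedule η α K ni nf k : ℝ)
          -- The factor `1 / h ^ α` from the smaller batch cancels against `h ^ α` in the coverage
          -- bound.
          have hden : (d : ℝ) ^ (2 / p) * L / (lam * n) ≤
              (d : ℝ) ^ (2 / p) * L / (lam * ni) / h ^ α := by
            rw [div_div]
            refine div_le_div_of_nonneg_left (by positivity) (by positivity) ?_
            rw [mul_assoc, mul_comm (ni : ℝ)]
            exact mul_le_mul_of_nonneg_left hnk_ge hlam.le
          calc Cs * (h ^ 2 * h ^ α) * (κ * ((d : ℝ) ^ (2 / p) * L / (lam * n)))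
              ≤ Cs * (h ^ 2 * h ^ α) *
                (κ * (η ^ 2 * xi d p R γ lam η δ (K + 1) ni / h ^ α)) := by
                refine mul_le_mul_of_nonneg_left (mul_le_mul_of_nonneg_left
                  (hden.trans (div_le_div_of_nonneg_right hxi2 hhα.le)) hκ.le) (by positivity)
            _ = κ * (h * η) ^ 2 * (Cs * xi d p R γ lam η δ (K + 1) ni) := by field_simp
            _ ≤ κ * (h * η) ^ 2 * (c₁ ^ 2 / κ) :=
                mul_le_mul_of_nonneg_left hxiLC (by positivity)
            _ = c₁ ^ 2 * (h * η) ^ 2 := by field_simp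
            _ ≤ (γ * R) ^ 2 * (h * η) ^ 2 :=
                mul_le_mul_of_nonneg_right (pow_le_pow_left₀ hc₁.le hγR1 2) (sq_nonneg _)
            _ = (γ * (η ^ (k + 1) * R)) ^ 2 := by
                rw [pow_succ]
                ring
      · have hb_eq : batchSchedule η α K ni nf k = nf := by
          rw [batchSchedule, if_neg (by omega)]
        have hnk : 0 < batchSchedule η α K ni nf k := hb_eq.symm ▸ hnf
        have hθ2 : lpNorm 2 (θ - θs) ≤ r₀ := by
          refine (lpNorm_two_le hp hp2 _).trans (hθk.trans ?_)
          rw [heq, hK]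
          exact (pow_decayRounds_mul_lt hη1 hR hr₀).le
        have hcovk : coverage D φ (softmaxPolicy π₀ φ θ) (softmaxPolicy π₀ φ θs) ≤
            Real.exp (2 * r₀) :=
          (coverage_softmax_le_exp hφ D π₀ θ θs).trans (Real.exp_le_exp.2 (by linarith))
        have hgoal := iidLaw_dpo_round_lpNorm (D := D) (ρ := C₁ * ε) hd hφ hp hp2 hγ hR
          hc₁ hγR1 hγR2 hnk hb_eq.le hr hθs2 (upd k θ) (hbest k θ) (hmin k θ) (Nat.le_add_left 1 K)
          hδ hδ1 huf hlam hcovf hcovk (Real.exp_pos _).le (by positivity) ?_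
        · simpa only [hS, Set.mem_ofPred_eq, if_neg (show ¬ k + 1 ≤ K by omega)] using hgoal
        · rw [hb_eq]
          have hxi2 := div_le_sq_mul_xi (d := d) (p := p) hγR hlam hη huf
          have hx0 : η ^ 2 * xi d p R γ lam η δ (K + 1) nf ≤ b * (γ ^ 2 * ε ^ 2) :=
            (mul_le_mul_of_nonneg_left hxf (sq_nonneg η)).trans
              (mul_le_of_le_one_left (by positivity) (pow_le_one₀ hη.le hη1.le))
          refine (mul_le_mul_of_nonneg_left (mul_le_mul_of_nonneg_left (hxi2.trans hx0) hκ.le)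
            (Real.exp_pos _).le).trans (le_of_eq ?_)
          rw [mul_pow, mul_pow, hC₁, Real.sq_sqrt (by positivity)]
          ring
    have h0 : (0 : Fin d → ℝ) ∈ S 0 := by
      rw [hS, Set.mem_ofPred_eq, if_pos (Nat.zero_le K), zero_sub, lpNorm_neg hp0, pow_zero,
        one_mul]
      exact hθsp
    have hfinal := dpoLaw_compl_le S _ h0 (K + 1) hround
    have hset : S (K + 1) = {θ | lpNorm p (θ - θs) ≤ C₁ * ε} := by
      simp only [hS, if_neg (show ¬ K + 1 ≤ K by omega)]
    rw [hset] at hfinal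
    refine ofReal_one_sub_le_toOuterMeasure _ _ hδ.le (hfinal.trans (le_of_eq ?_))
    rw [← ENNReal.ofReal_natCast, ← ENNReal.ofReal_mul (Nat.cast_nonneg _),
      mul_div_cancel₀ _ (Nat.cast_ne_zero.2 (Nat.succ_ne_zero K))]
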